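/- A \emph{Buffon machine} is here a register program (finite control, integer counters, string registers holding finite bit strings) that may flip an unbiased coin and may call, as an external routine, a perfect Bernoulli generator $\Gamma\mathrm{B}(\lambda)$ whose parameter $\lambda$ is not known to it. All coin flips and generator outcomes are independent. It \emph{strongly simulates} a family of discrete distributions $D_\lambda$, $\lambda\in(0,1)$, if for every $\lambda\in(0,1)$ it halts with probability $1$, its output has exactly the distribution $D_\lambda$, and its cost $C$ (the number of coin flips plus the number of calls to $\Gamma\mathrm{B}(\lambda)$) has exponential tails: there are constants $K$ and $0\le\rho<1$, possibly depending on $\lambda$, with $\mathbb P(C>m)\le K\rho^m$ for all integers $m\ge 0$. For a class $\mathcal P$ of permutations, with $P_n$ members of size $n$, the \emph{von Neumann schema} $\Gamma\mathrm{VN}[\mathcal P](\lambda)$ repeats the following trial until it succeeds: draw $N$ with $\mathbb P(N=n)=(1-\lambda)\lambda^n$, by calling $\Gamma\mathrm{B}(\lambda)$ until the first failure and counting the successes; draw independent uniform $U_1,\dots,U_N\in[0,1]$; succeed, and return $N$, if the order type of $(U_1,\dots,U_N)$ (each $U_j$ replaced by its rank) belongs to $\mathcal P$. Let $\mathcal R$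 be the class of sorted permutations and $\mathcal S$ the class of non-empty permutations whose first element is the largest. \textbf{Theorem.} The following two explicit Buffon machines, each of which uses a single string register (besides three integer counters), implement $\Gamma\mathrm{VN}[\mathcal R]$ and $\Gamma\mathrm{VN}[\mathcal S]$ respectively. In each trial $N$ is drawn as above; the bits of the $U_j$ are then produced by coin flips, only when needed, and a trial is abandoned as soon as it is known to fail. For $\mathcal R$, each new entry is generated bit by bit and compared with the preceding one, whose known leading bits are kept in the string register; the trial fails if the new entry is smaller, and otherwise its known bits replace the contents of the register. For $\mathcal S$, each new entry is compared in the same way with $U_1$, whose known leading bits are kept in the string register, and the trial fails if the new entry is larger, or if $N=0$. "Implement" means that for every $\lambda\in(0,1)$ the sequence of outcomes of $\Gamma\mathrm{B}(\lambda)$, the output, and the number of calls to $\Gamma\mathrm{B}(\lambda)$ have jointly the same distribution for the machine as for the schema. Moreover: (i) the machine for $\mathcal R$ strongly simulates the Poisson distribution $\mathbb P(X=n)=e^{-\lambda}\lambda^n/n!$, $n\ge0$, and $\sum_{n\ge0}R_n z^n/n!=e^z$ for all real $z$; (ii) the machine for $\mathcal S$ strongly simulates the logarithmic-series distribution $\mathbb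 P(X=n)=\frac1L\,\frac{\lambda^n}{n}$, $n\ge1$, where $L=\log(1-\lambda)^{-1}$, and $\sum_{n\ge0}S_n z^n/n!=\log(1-z)^{-1}$ for all real $z$ with $|z|<1$. -/

import Mathlib

open MeasureTheory ProbabilityTheory

namespace Buffon

/-! ## Register machines with a coin and a Bernoulli generator as external routines

A program is a finite list of instructions. The registers are integer counters and string
registers (finite sequences of bits), both named by natural numbers. Labels are positions in the
list. An instruction that does not jump passes control to the next one. -/

/-- The instruction set. -/
inductive Instr : Type
  /-- unconditional jump to label `l` -/
  | goto (l : ℕ)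
  /-- counter `c := 0` -/
  | zero (c : ℕ)
  /-- counter `c := c + 1` -/
  | inc (c : ℕ)
  /-- if counter `c` is `0`, jump to `l`; otherwise `c := c - 1` -/
  | decOrJump (c l : ℕ)
  /-- flip the unbiased coin and jump to `l` if the outcome is `1` -/
  | flip (l : ℕ)
  /-- call the Bernoulli generator given as input and jump to `l` if the outcome is `1` -/
  | call (l : ℕ)
  /-- string register `s :=` empty string -/
  | clear (s : ℕ)
  /-- append the bit `b` at the end of string register `s` -/
  | push (s : ℕ) (b : Bool)
  /-- keep only the first `c` bits of string register `s`, where `c` is a counter -/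
  | trunc (s c : ℕ)
  /-- inspect the bit of string register `s` whose position (counted from `0`) is in counter `c`:
  jump to `l0` if it is `0`, to `l1` if it is `1`, and do not jump if there is no such bit -/
  | read (s c l0 l1 : ℕ)
  /-- write the value of counter `c` on the output and halt -/
  | ret (c : ℕ)

abbrev Program : Type := List Instr

/-- The string registers that an instruction refers to. -/
def Instr.strings : Instr → Finset ℕ
  | .clear s => {s}
  | .push s _ => {s}
  | .trunc s _ => {s}
  | .read s _ _ _ => {s}
  | _ => ∅

/-- The string registers that a program uses. -/
def stringRegisters (p : Program) : Finset ℕ :=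
  p.foldr (fun i t => i.strings ∪ t) ∅

/-- What the outside world supplies: the successive outcomes of the unbiased coin (`coin`) and the
successive outcomes of the Bernoulli generator (`input`). -/
abbrev Source : Type := (ℕ → Bool) × (ℕ → Bool)

abbrev Source.coin (ω : Source) : ℕ → Bool := ω.1

abbrev Source.input (ω : Source) : ℕ → Bool := ω.2

/-- Configurations: current label, contents of the registers, and the numbers of coin flips and of
calls to the Bernoulli generator made so far. -/
structure Config : Type where
  pc : ℕ
  counter : ℕ → ℕ
  string : ℕ → List Bool
  flips : ℕ
  calls : ℕ

/-- At the start all registers are empty. -/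
def Config.init : Config := ⟨0, fun _ => 0, fun _ => [], 0, 0⟩

/-- The effect of one instruction. -/
def Instr.exec (ω : Source) (k : Config) : Instr → Config
  | .goto l => { k with pc := l }
  | .zero c => { k with pc := k.pc + 1, counter := Function.update k.counter c 0 }
  | .inc c => { k with pc := k.pc + 1, counter := Function.update k.counter c (k.counter c + 1) }
  | .decOrJump c l =>
      if k.counter c = 0 then { k with pc := l }
      else { k with pc := k.pc + 1, counter := Function.update k.counter c (k.counter c - 1) }
  | .flip l =>
      { k with pc := if ω.coin k.flips then l else k.pc + 1, flips := k.flips + 1 }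
  | .call l =>
      { k with pc := if ω.input k.calls then l else k.pc + 1, calls := k.calls + 1 }
  | .clear s => { k with pc := k.pc + 1, string := Function.update k.string s [] }
  | .push s b =>
      { k with pc := k.pc + 1, string := Function.update k.string s (k.string s ++ [b]) }
  | .trunc s c =>
      { k with
        pc := k.pc + 1
        string := Function.update k.string s ((k.string s).take (k.counter c)) }
  | .read s c l0 l1 =>
      match (k.string s)[k.counter c]? with
      | none => { k with pc := k.pc + 1 }
      | some false => { k with pc := l0 }
      | some true => { k with pc := l1 }
  | .ret _ => k

/-- One step of a program; outside the program nothing happens any more. -/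
def step (p : Program) (ω : Source) (k : Config) : Config :=
  match p[k.pc]? with
  | none => k
  | some i => i.exec ω k

/-- The configuration after `t` steps. -/
def run (p : Program) (ω : Source) (t : ℕ) : Config :=
  (step p ω)^[t] Config.init

/-- The program halts with output `n`, after `f` coin flips and `c` calls to the Bernoulli
generator. -/
def HaltsWith (p : Program) (ω : Source) (n f c : ℕ) : Prop :=
  ∃ t r, p[(run p ω t).pc]? = some (Instr.ret r) ∧
    (run p ω t).counter r = n ∧ (run p ω t).flips = f ∧ (run p ω t).calls = c

/-! ## Randomness and strong simulation -/

/-- The law of an infinite sequence of independent Bernoulli variables of parameter `q`. -/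
noncomputable def bernoulliSequence (q : unitInterval) : Measure (ℕ → Bool) :=
  Measure.infinitePi fun _ : ℕ => bernoulliMeasure true false q

/-- The parameter `1/2` of the unbiased coin. -/
noncomputable def half : unitInterval := ⟨1 / 2, by norm_num, by norm_num⟩

/-- Unbiased coin flips and, independently of them, a perfect Bernoulli generator of parameter
`lam`. -/
noncomputable def source (lam : unitInterval) : Measure Source :=
  (bernoulliSequence half).prod (bernoulliSequence lam)

/-- `p` strongly simulates the distributions `law lam`, for `0 < lam < 1`: supplied with a
Bernoulli generator of the (unknown) parameter `lam`, the program halts with probability `1`, its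
output has exactly the distribution `law lam`, and its cost has exponential tails. The cost counts
the coin flips and also the calls to the Bernoulli generator; runs that do not halt have infinite
cost. -/
def StronglySimulates (p : Program) (law : ℝ → ℕ → ℝ) : Prop :=
  ∀ lam : unitInterval, 0 < lam → lam < 1 →
    (∀ᵐ ω ∂source lam, ∃ n f c, HaltsWith p ω n f c) ∧
    (∀ n, source lam {ω | ∃ f c, HaltsWith p ω n f c} = ENNReal.ofReal (law lam n)) ∧
    ∃ K ρ : ℝ, 0 ≤ ρ ∧ ρ < 1 ∧ ∀ m : ℕ,
      source lam {ω | ¬ ∃ n f c, HaltsWith p ω n f c ∧ f + c ≤ m} ≤ ENNReal.ofReal (K * ρ ^ m)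

/-- The Poisson distribution of parameter `lam`. -/
noncomputable def poissonLaw (lam : ℝ) (n : ℕ) : ℝ :=
  Real.exp (-lam) * lam ^ n / n.factorial

/-- The logarithmic-series distribution of parameter `lam`. -/
noncomputable def logarithmicLaw (lam : ℝ) (n : ℕ) : ℝ :=
  if n = 0 then 0 else 1 / Real.log (1 - lam)⁻¹ * (lam ^ n / n)

/-! ## Classes of permutations and the von Neumann schema -/

/-- A class of permutations: for every size `n`, a set of permutations of `n` elements. -/
abbrev PermClass : Type := ∀ n : ℕ, Set (Equiv.Perm (Fin n))

/-- The class `R` of sorted permutations. -/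
def sortedClass : PermClass := fun _ => {σ | Monotone σ}

/-- The class `S` of (nonempty) permutations whose first element is the largest. -/
def firstLargestClass : PermClass := fun n => {σ | ∃ h : 0 < n, ∀ i, σ i ≤ σ ⟨0, h⟩}

/-- The coefficient `P_n / n!` of the exponential generating function of a class. -/
noncomputable def egfCoeff (P : PermClass) (n : ℕ) : ℝ :=
  (P n).ncard / n.factorial

/-- The order type of a vector: every entry is replaced by its rank. -/
def orderType {n : ℕ} {α : Type*} [LinearOrder α] (u : Fin n → α) : Equiv.Perm (Fin n) :=
  (Tuple.sort u)⁻¹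

/-- Geometric variable read off from Bernoulli variables: the number of successes from place `s`
on, before the first failure. -/
noncomputable def geometric (x : ℕ → Bool) (s : ℕ) : ℕ :=
  sInf {n | x (s + n) = false}

/-- The number of Bernoulli variables consumed by the geometric variables of the first `k` trials
(each of them takes its successes and the failure that ends them). -/
noncomputable def consumed (x : ℕ → Bool) : ℕ → ℕ
  | 0 => 0
  | k + 1 => consumed x k + geometric x (consumed x k) + 1

/-- The size `N` drawn in trial number `k`. -/
noncomputable def trialSize (x : ℕ → Bool) (k : ℕ) : ℕ :=
  geometric x (consumed x k)

/-- Trial number `k` draws `N` and then the vector `(U_1, …, U_N)`; it succeeds if the order type of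
the vector is in `P`. -/
def TrialSucceeds (P : PermClass) (x : ℕ → Bool) (U : ℕ × ℕ → unitInterval) (k : ℕ) : Prop :=
  orderType (fun j : Fin (trialSize x k) => U (k, j)) ∈ P (trialSize x k)

/-- The von Neumann schema relative to `P` stops at the first trial that succeeds and returns its
`N`; here the result is `n`, and `c` calls to the Bernoulli generator have been made. -/
def SchemaReturns (P : PermClass) (x : ℕ → Bool) (U : ℕ × ℕ → unitInterval) (n c : ℕ) : Prop :=
  ∃ k, (∀ i < k, ¬ TrialSucceeds P x U i) ∧ TrialSucceeds P x U k ∧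
    trialSize x k = n ∧ consumed x (k + 1) = c

/-- The randomness of the schema: a Bernoulli generator of parameter `lam` and, independently of
it, independent uniform variables on `[0,1]`, with a fresh sequence for every trial. -/
noncomputable def schemaSource (lam : unitInterval) :
    Measure ((ℕ → Bool) × (ℕ × ℕ → unitInterval)) :=
  (bernoulliSequence lam).prod (Measure.infinitePi fun _ : ℕ × ℕ => (volume : Measure unitInterval))

/-- `p` implements the von Neumann schema relative to `P`: jointly, the outcomes of the Bernoulli
generator, the output and the number of calls to the generator (hence also the number of trials)
are distributed in the program as in the schema. -/
def ImplementsSchema (p : Program) (P : PermClass) : Prop :=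
  ∀ lam : unitInterval, 0 < lam → lam < 1 →
    ∀ A : Set (ℕ → Bool), MeasurableSet A → ∀ n c : ℕ,
      source lam {ω | ω.input ∈ A ∧ ∃ f, HaltsWith p ω n f c} =
        schemaSource lam {η | η.1 ∈ A ∧ SchemaReturns P η.1 η.2 n c}

/-! ## The two machines

Counter `0` is `N`, counter `1` is the number of entries of the vector `U` that are still to be
drawn, counter `2` is a position in a binary expansion. The bits of the `U_j` are produced on a
call-by-need basis, and a trial is abandoned as soon as it is known to fail. -/

/-- The von Neumann machine of the sorted permutations. The string register `0` holds the known
leading bits of the last entry `U_j` drawn. The next entry is generated bit by bit as long as it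
agrees with `U_j`; a bit of `U_j` that is needed and not yet known is generated then. -/
def sortedMachine : Program :=
  [ .zero 0,            -- 0: a new trial
    .zero 1,
    .clear 0,
    .call 5,            -- 3: N is geometric
    .goto 8,
    .inc 0,             -- 5
    .inc 1,
    .goto 3,
    .decOrJump 1 27,    -- 8: accept if N = 0; else the first entry, no bit known yet
    .decOrJump 1 27,    -- 9: accept if no entry is left; else draw the next entry
    .zero 2,
    .read 0 2 17 23,    -- 11: the bit of U_j at the current position
    .flip 15,           -- not yet known: generate it
    .push 0 false,
    .goto 11,
    .push 0 true,       -- 15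
    .goto 11,
    .flip 20,           -- 17: it is 0; the bit of the next entry is 1 (to 20) or 0
    .inc 2,
    .goto 11,
    .trunc 0 2,         -- 20: the next entry is larger; it replaces U_j
    .push 0 true,
    .goto 9,
    .flip 25,           -- 23: it is 1; the bit of the next entry is 1 (to 25) or 0
    .goto 0,            -- the next entry is smaller: the trial fails
    .inc 2,             -- 25
    .goto 11,
    .ret 0 ]            -- 27

/-- The von Neumann machine of the permutations whose first element is the largest. The string
register `0` holds the known leading bits of the first entry `U_1`. Every further entry is
generated bit by bit as long as it agrees with `U_1`; a bit of `U_1` that is needed and not yet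
known is generated then. -/
def firstLargestMachine : Program :=
  [ .zero 0,            -- 0: a new trial
    .zero 1,
    .clear 0,
    .call 5,            -- 3: N is geometric
    .goto 8,
    .inc 0,             -- 5
    .inc 1,
    .goto 3,
    .decOrJump 1 0,     -- 8: the trial fails if N = 0; else the first entry, no bit known yet
    .decOrJump 1 24,    -- 9: accept if no entry is left; else draw the next entry
    .zero 2,
    .read 0 2 17 20,    -- 11: the bit of U_1 at the current position
    .flip 15,           -- not yet known: generate it
    .push 0 false,
    .goto 11,
    .push 0 true,       -- 15
    .goto 11,
    .flip 0,            -- 17: it is 0; if the bit of the new entry is 1, the trial fails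
    .inc 2,
    .goto 11,
    .flip 22,           -- 20: it is 1; the bit of the new entry is 1 (to 22) or 0
    .goto 9,            -- the new entry is smaller
    .inc 2,             -- 22
    .goto 11,
    .ret 0 ]            -- 24

end Buffon
open Buffon

namespace Buffon

/-! A program run on random bits is a Markov chain on configurations, because each outcome is
consulted at most once (`lintegral_iterate_succ`). Probabilities of events about the output and the
number of calls are therefore values of harmonic functions. If a bounded function `Φ` is harmonic
along the chain and equals the indicator of the event at halting configurations, the supermartingale
bound applied to both `Φ` and `1 - Φ`, together with almost sure halting, gives exactly `Φ
Config.init` (`measure_haltsWith_eq`).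

For the two machines `Φ` is explicit. Given its known leading bits, an entry is uniform on a dyadic
interval. The chance that the current trial still succeeds is thus the average over that interval of
the chance given the exact value `u`: `(1 - u) ^ m / m!` for `m` further entries sorted above `u`,
and `u ^ m` for `m` further entries below `u`. Splitting the interval in two accounts for the
generation of a bit, and a similar identity accounts for each comparison of bits. At the start of
the vector these averages reduce to `1 / N!` and `1 / N`. What remains is a recursion in `N` and the
number of calls, which is what `HasTrialValue` isolates.

In that recursion the parameter of the generator may vary from call to call. A constant parameter
gives the law of the output, by an explicit solution (`HasTrialValue.stronglySimulates`). Parameters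
`0` and `1` freeze the generator to a prescribed sequence `x`; the solution is then `schemaValue`,
which is also the probability computed for the schema given `x`. Fubini over `x` gives the joint
statement (`HasTrialValue.implementsSchema`). On the side of the schema, the order type of
independent uniform variables is uniform by exchangeability, and trials are independent.

Halting and exponential tails come from a Lyapunov function that shrinks in the mean by a fixed
factor at every step (`DecaysGeometrically`). Finally, both classes are counted: there is one sorted
permutation of each size, and `(n - 1)!` permutations of size `n ≥ 1` begin with their maximum. -/

theorem measurable_bool_apply {α β : Type*} [MeasurableSpace α] [MeasurableSpace β]
    {h : Bool → α → β} (hh : ∀ b, Measurable (h b)) {g : α → Bool} (hg : Measurable g) :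
    Measurable fun a => h (g a) a := by
  have : Measurable fun z : Bool × α => h z.1 z.2 := measurable_from_prod_countable_right hh
  exact this.comp (hg.prodMk measurable_id)

/-! ### Resampling one coordinate of a product measure -/

/-- Overwriting one coordinate by an independent copy leaves a product law unchanged, as is checked
on finite boxes. This integrates out a single outcome without shifting the sequence. -/
theorem map_update_infinitePi {ι : Type*} [DecidableEq ι] {X : ι → Type*}
    [∀ i, MeasurableSpace (X i)] (μ : ∀ i, Measure (X i)) [∀ i, IsProbabilityMeasure (μ i)]
    (a : ι) :
    ((Measure.infinitePi μ).prod (μ a)).map (fun p => Function.update p.1 a p.2) =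
      Measure.infinitePi μ := by
  have hm : Measurable (fun p : (∀ i, X i) × X a => Function.update p.1 a p.2) := by
    fun_prop
  refine Measure.eq_infinitePi μ fun s t ht => ?_
  rw [Measure.map_apply hm (MeasurableSet.pi s.countable_toSet fun i _ => ht i)]
  have : (fun p : (∀ i, X i) × X a => Function.update p.1 a p.2) ⁻¹' ((s : Set ι).pi t) =
      (((s.erase a : Finset ι) : Set ι).pi t) ×ˢ (if a ∈ s then t a else Set.univ) := by
    ext ⟨x, y⟩
    simp only [Set.mem_preimage, Set.mem_pi, Set.mem_prod, Finset.mem_coe, Finset.mem_erase]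
    constructor
    · intro h
      refine ⟨fun i hi => by simpa [hi.1] using h i hi.2, ?_⟩
      split_ifs with has
      · simpa using h a has
      · trivial
    · rintro ⟨h1, h2⟩ i hi
      by_cases hia : i = a
      · subst hia
        simpa [hi] using h2
      · simpa [hia] using h1 i ⟨hia, hi⟩
  rw [this, Measure.prod_prod, Measure.infinitePi_pi μ fun i _ => ht i]
  by_cases has : a ∈ s
  · rw [if_pos has, Finset.prod_erase_mul _ _ has]
  · rw [if_neg has, measure_univ, mul_one, Finset.erase_eq_of_notMem has]

/-- The probability that a Bernoulli variable of parameter `q` takes the value `b`. -/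
noncomputable def weight (q : unitInterval) (b : Bool) : ℝ := if b then (q : ℝ) else 1 - q

theorem weight_nonneg (q : unitInterval) (b : Bool) : 0 ≤ weight q b := by
  unfold weight
  split_ifs
  · exact q.2.1
  · linarith [q.2.2]

theorem sum_weight (q : unitInterval) : weight q true + weight q false = 1 := by
  simp [weight]

theorem sum_ofReal_weight (q : unitInterval) :
    ENNReal.ofReal (weight q true) + ENNReal.ofReal (weight q false) = 1 := by
  rw [← ENNReal.ofReal_add (weight_nonneg _ _) (weight_nonneg _ _), sum_weight,
    ENNReal.ofReal_one]

theorem bernoulliMeasure_singleton (q : unitInterval) (b : Bool) :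
    bernoulliMeasure true false q {b} = ENNReal.ofReal (weight q b) := by
  rw [← ofReal_measureReal]
  cases b
  · rw [bernoulliMeasure_real_apply_of_notMem_of_mem] <;> simp [weight]
  · rw [bernoulliMeasure_real_apply_of_mem_of_notMem] <;> simp [weight]

theorem lintegral_bernoulliMeasure (q : unitInterval) (f : Bool → ENNReal) :
    ∫⁻ b, f b ∂bernoulliMeasure true false q =
      ∑ b, ENNReal.ofReal (weight q b) * f b := by
  rw [lintegral_fintype]
  simp_rw [bernoulliMeasure_singleton, mul_comm]

/-- Independent Bernoulli variables with parameters `q 0, q 1, …`. -/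
noncomputable abbrev bernoulliProduct (q : ℕ → unitInterval) : Measure (ℕ → Bool) :=
  Measure.infinitePi fun i => bernoulliMeasure true false (q i)

theorem lintegral_bernoulliProduct (q : ℕ → unitInterval) (a : ℕ)
    (h : Bool → (ℕ → Bool) → ENNReal) (hm : ∀ b, Measurable (h b))
    (hd : ∀ b x c, h b (Function.update x a c) = h b x) :
    ∫⁻ x, h (x a) x ∂bernoulliProduct q =
      ∑ b, ENNReal.ofReal (weight (q a) b) * ∫⁻ x, h b x ∂bernoulliProduct q := by
  have hm' : Measurable fun x : ℕ → Bool => h (x a) x :=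
    measurable_bool_apply hm (measurable_pi_apply a)
  have hu : Measurable (fun p : (ℕ → Bool) × Bool => Function.update p.1 a p.2) := by
    fun_prop
  conv_lhs => rw [bernoulliProduct, ← map_update_infinitePi _ a]
  rw [lintegral_map hm' hu]
  refine (lintegral_prod _ (hm'.comp hu).aemeasurable).trans ?_
  simp only [Function.comp_apply, Function.update_self, hd, lintegral_bernoulliMeasure]
  rw [lintegral_finsetSum _ fun b _ => (hm b).const_mul _]
  exact Finset.sum_congr rfl fun b _ => lintegral_const_mul _ (hm b)

/-! ### The program as a Markov chain -/

/-- A fair coin and, independently, a generator whose parameter may change from call to call. -/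
noncomputable def variableSource (q : ℕ → unitInterval) : Measure Source :=
  (bernoulliProduct fun _ => half).prod (bernoulliProduct q)

instance (q : ℕ → unitInterval) : IsProbabilityMeasure (variableSource q) := by
  unfold variableSource; infer_instance

theorem source_eq_variableSource (lam : unitInterval) :
    source lam = variableSource fun _ => lam := rfl

/-- A source all of whose coin flips are `a` and all of whose generator outcomes are `b`. -/
abbrev constSource (a b : Bool) : Source := (fun _ => a, fun _ => b)

/-- Whenever an outcome is read, the corresponding index advances, so no outcome is ever read twice.
This is the source of the Markov property. -/
theorem step_cases (p : Program) (k : Config) :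
    (∃ k', ∀ ω, step p ω k = k') ∨
    (∃ f : Bool → Config, (∀ b, (f b).flips = k.flips + 1 ∧ (f b).calls = k.calls) ∧
      ∀ ω, step p ω k = f (ω.coin k.flips)) ∨
    (∃ f : Bool → Config, (∀ b, (f b).flips = k.flips ∧ (f b).calls = k.calls + 1) ∧
      ∀ ω, step p ω k = f (ω.input k.calls)) := by
  rcases h : p[k.pc]? with _ | i
  · exact .inl ⟨k, fun ω => by simp [step, h]⟩
  cases i
  case flip l =>
    exact .inr (.inl ⟨fun b => { k with pc := if b then l else k.pc + 1, flips := k.flips + 1 },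
      by simp, fun ω => by simp [step, h, Instr.exec]⟩)
  case call l =>
    exact .inr (.inr ⟨fun b => { k with pc := if b then l else k.pc + 1, calls := k.calls + 1 },
      by simp, fun ω => by simp [step, h, Instr.exec]⟩)
  all_goals exact .inl ⟨step p (constSource true true) k, fun ω => by simp [step, h, Instr.exec]⟩

theorem step_le (p : Program) (ω : Source) (k : Config) :
    k.flips ≤ (step p ω k).flips ∧ k.calls ≤ (step p ω k).calls ∧
      (step p ω k).flips + (step p ω k).calls ≤ k.flips + k.calls + 1 := by
  rcases h : p[k.pc]? with _ | i
  · simp [step, h]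
  cases i <;> simp only [step, h, Instr.exec] <;> (try split) <;>
    refine ⟨?_, ?_, ?_⟩ <;> (try dsimp only) <;> omega

theorem step_congr (p : Program) (k : Config) {ω ω' : Source}
    (h1 : ω.coin k.flips = ω'.coin k.flips) (h2 : ω.input k.calls = ω'.input k.calls) :
    step p ω k = step p ω' k := by
  rcases step_cases p k with ⟨k', h⟩ | ⟨f, -, h⟩ | ⟨f, -, h⟩
  · rw [h, h]
  · rw [h, h, h1]
  · rw [h, h, h2]

theorem step_eq_constSource (p : Program) (ω : Source) (k : Config) :
    step p ω k = step p (constSource (ω.coin k.flips) (ω.input k.calls)) k :=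
  step_congr p k rfl rfl

theorem iterate_step_congr (p : Program) (t : ℕ) (k : Config) {ω ω' : Source}
    (h1 : ∀ i, k.flips ≤ i → ω.coin i = ω'.coin i)
    (h2 : ∀ i, k.calls ≤ i → ω.input i = ω'.input i) :
    (step p ω)^[t] k = (step p ω')^[t] k := by
  induction t generalizing k with
  | zero => rfl
  | succ t ih =>
    rw [Function.iterate_succ_apply, Function.iterate_succ_apply,
      ← step_congr p k (h1 _ le_rfl) (h2 _ le_rfl)]
    have := step_le p ω k
    exact ih _ (fun i hi => h1 i (by omega)) (fun i hi => h2 i (by omega))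

/-- The discrete σ-algebra causes no trouble: from a fixed start, `t` steps only branch on finitely
many bits, so every function of the resulting configuration is measurable. -/
instance : MeasurableSpace Config := ⊤

theorem measurable_iterate_step (p : Program) (t : ℕ) (k : Config) :
    Measurable fun ω => (step p ω)^[t] k := by
  induction t generalizing k with
  | zero => exact measurable_const
  | succ t ih =>
    simp only [Function.iterate_succ_apply]
    rcases step_cases p k with ⟨k', h⟩ | ⟨f, -, h⟩ | ⟨f, -, h⟩ <;> simp only [h]
    · exact ih k'
    · exact measurable_bool_apply (fun b => ih (f b)) ((measurable_pi_apply _).comp measurable_fst)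
    · exact measurable_bool_apply (fun b => ih (f b)) ((measurable_pi_apply _).comp measurable_snd)

theorem measurable_comp_iterate_step (p : Program) (t : ℕ) (k : Config) {β : Type*}
    [MeasurableSpace β] (F : Config → β) : Measurable fun ω => F ((step p ω)^[t] k) :=
  (measurable_from_top (f := F)).comp (measurable_iterate_step p t k)

/-- The Markov property. Summing over both a coin outcome and a generator outcome treats all
instructions uniformly: an outcome that the instruction does not read contributes total weight `1`.
-/
theorem lintegral_iterate_succ (p : Program) (q : ℕ → unitInterval) (F : Config → ENNReal)
    (t : ℕ) (k : Config) :
    ∫⁻ ω, F ((step p ω)^[t + 1] k) ∂variableSource q =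
      ∑ a, ∑ b, ENNReal.ofReal (weight half a) * (ENNReal.ofReal (weight (q k.calls) b) *
        ∫⁻ ω, F ((step p ω)^[t] (step p (constSource a b) k)) ∂variableSource q) := by
  have key (q : unitInterval) (x : ENNReal) : ENNReal.ofReal (weight q true) * x +
      ENNReal.ofReal (weight q false) * x = x := by
    rw [← add_mul, sum_ofReal_weight, one_mul]
  have hF (k) := measurable_comp_iterate_step p t k F
  simp only [Function.iterate_succ_apply]
  rcases step_cases p k with ⟨k', h⟩ | ⟨f, hf, h⟩ | ⟨f, hf, h⟩ <;> simp only [h]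
  · simp only [Fintype.sum_bool, ← mul_add, key]
  · simp only [Fintype.sum_bool, ← mul_add, key]
    have hm : Measurable fun ω : Source => F ((step p ω)^[t] (f (ω.1 k.flips))) :=
      measurable_bool_apply (fun b => hF (f b)) ((measurable_pi_apply _).comp measurable_fst)
    have hd (y : ℕ → Bool) := lintegral_bernoulliProduct (fun _ => half) k.flips
      (fun b x => F ((step p (x, y))^[t] (f b)))
      (fun b => (hF (f b)).comp (measurable_id.prodMk measurable_const))
      (fun b x c => by
        congr 1
        refine iterate_step_congr p t _ (fun i hi => ?_) fun i hi => rfl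
        rw [(hf b).1] at hi
        exact Function.update_of_ne (by omega) _ _)
    unfold variableSource
    rw [lintegral_prod_symm _ hm.aemeasurable]
    refine (lintegral_congr hd).trans ?_
    rw [lintegral_finsetSum, ← Fintype.sum_bool (fun b => ENNReal.ofReal (weight half b) *
      ∫⁻ ω, F ((step p ω)^[t] (f b)) ∂_)]
    · refine Finset.sum_congr rfl fun b _ => ?_
      rw [lintegral_const_mul, lintegral_prod_symm _ (hF (f b)).aemeasurable]
      exact (hF (f b)).lintegral_prod_left'
    · intro b _
      exact ((hF (f b)).lintegral_prod_left').const_mul _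
  · simp only [Fintype.sum_bool, ← mul_add, key]
    have hm : Measurable fun ω : Source => F ((step p ω)^[t] (f (ω.2 k.calls))) :=
      measurable_bool_apply (fun b => hF (f b)) ((measurable_pi_apply _).comp measurable_snd)
    have hd (x : ℕ → Bool) := lintegral_bernoulliProduct q k.calls
      (fun b y => F ((step p (x, y))^[t] (f b)))
      (fun b => (hF (f b)).comp (measurable_const.prodMk measurable_id))
      (fun b y c => by
        congr 1
        refine iterate_step_congr p t _ (fun i hi => rfl) fun i hi => ?_
        rw [(hf b).2] at hi
        exact Function.update_of_ne (by omega) _ _)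
    unfold variableSource
    rw [lintegral_prod _ hm.aemeasurable]
    refine (lintegral_congr hd).trans ?_
    rw [lintegral_finsetSum, ← Fintype.sum_bool (fun b => ENNReal.ofReal (weight (q k.calls) b) *
      ∫⁻ ω, F ((step p ω)^[t] (f b)) ∂_)]
    · refine Finset.sum_congr rfl fun b _ => ?_
      rw [lintegral_const_mul, lintegral_prod _ (hF (f b)).aemeasurable]
      exact (hF (f b)).lintegral_prod_right'
    · intro b _
      exact ((hF (f b)).lintegral_prod_right').const_mul _

/-- The expected value of `Φ` after one step from `k`. -/
noncomputable def mean (p : Program) (q : ℕ → unitInterval) (Φ : Config → ℝ) (k : Config) : ℝ :=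
  ∑ a, ∑ b, weight half a * (weight (q k.calls) b * Φ (step p (constSource a b) k))

theorem weight_half (a : Bool) : weight half a = 1 / 2 := by
  cases a <;> simp [weight, half]; norm_num

theorem mean_eq (p : Program) (q : ℕ → unitInterval) (Φ : Config → ℝ) (k : Config) :
    mean p q Φ k =
      (q k.calls * Φ (step p (constSource true true) k) +
        (1 - q k.calls) * Φ (step p (constSource true false) k) +
        (q k.calls * Φ (step p (constSource false true) k) +
        (1 - q k.calls) * Φ (step p (constSource false false) k))) / 2 := by
  simp only [mean, Fintype.sum_bool, weight_half]
  simp only [weight, if_true, Bool.false_eq_true, if_false]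
  ring

/-- Used with `ρ = 1` for the value functions and with `ρ < 1` for the Lyapunov functions. -/
theorem lintegral_iterate_le {p : Program} {q : ℕ → unitInterval} {V : Config → ℝ} {ρ : ℝ}
    {Inv : Config → Prop} (hρ : 0 ≤ ρ) (hV : ∀ k, Inv k → 0 ≤ V k)
    (hstep : ∀ ω k, Inv k → Inv (step p ω k)) (hmean : ∀ k, Inv k → mean p q V k ≤ ρ * V k)
    (t : ℕ) (k : Config) (hk : Inv k) :
    ∫⁻ ω, ENNReal.ofReal (V ((step p ω)^[t] k)) ∂variableSource q ≤
      ENNReal.ofReal (ρ ^ t * V k) := by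
  induction t generalizing k with
  | zero => simp
  | succ t ih =>
    rw [lintegral_iterate_succ p q (fun k => ENNReal.ofReal (V k))]
    have hw (a b : Bool) : 0 ≤ weight half a * (weight (q k.calls) b *
        (ρ ^ t * V (step p (constSource a b) k))) :=
      mul_nonneg (weight_nonneg _ _) (mul_nonneg (weight_nonneg _ _)
        (mul_nonneg (pow_nonneg hρ t) (hV _ (hstep _ k hk))))
    calc _ ≤ ∑ a, ∑ b, ENNReal.ofReal (weight half a) * (ENNReal.ofReal (weight (q k.calls) b) *
          ENNReal.ofReal (ρ ^ t * V (step p (constSource a b) k))) := by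
          gcongr with a _ b _
          exact ih _ (hstep _ k hk)
      _ = ENNReal.ofReal (ρ ^ t * mean p q V k) := by
          simp_rw [← ENNReal.ofReal_mul (weight_nonneg _ _)]
          simp_rw [← ENNReal.ofReal_sum_of_nonneg fun b _ => hw _ b]
          rw [← ENNReal.ofReal_sum_of_nonneg fun a _ => Finset.sum_nonneg fun b _ => hw a b]
          congr 1
          simp only [mean, Finset.mul_sum]
          refine Finset.sum_congr rfl fun a _ => Finset.sum_congr rfl fun b _ => ?_
          ring
      _ ≤ _ := by
          apply ENNReal.ofReal_le_ofReal
          rw [pow_succ, mul_assoc]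
          exact mul_le_mul_of_nonneg_left (hmean k hk) (pow_nonneg hρ t)

/-! ### Halting -/

/-- The program has reached a `ret` instruction with output and number of calls in `E`. -/
def HaltedIn (p : Program) (E : ℕ → ℕ → Prop) (k : Config) : Prop :=
  ∃ r, p[k.pc]? = some (Instr.ret r) ∧ E (k.counter r) k.calls

theorem step_of_halted {p : Program} {k : Config} {r : ℕ} (h : p[k.pc]? = some (Instr.ret r))
    (ω : Source) : step p ω k = k := by
  simp [step, h, Instr.exec]

theorem run_succ (p : Program) (ω : Source) (t : ℕ) : run p ω (t + 1) = step p ω (run p ω t) :=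
  Function.iterate_succ_apply' _ _ _

theorem exists_haltsWith_iff (p : Program) (E : ℕ → ℕ → Prop) (ω : Source) :
    (∃ n f c, HaltsWith p ω n f c ∧ E n c) ↔ ∃ t, HaltedIn p E (run p ω t) := by
  constructor
  · rintro ⟨n, f, c, ⟨t, r, h, rfl, -, rfl⟩, hE⟩
    exact ⟨t, r, h, hE⟩
  · rintro ⟨t, r, h, hE⟩
    exact ⟨_, _, _, ⟨t, r, h, rfl, rfl, rfl⟩, hE⟩

theorem measurableSet_haltedIn_run (p : Program) (E : ℕ → ℕ → Prop) (t : ℕ) :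
    MeasurableSet {ω | HaltedIn p E (run p ω t)} :=
  measurableSet_setOfPred.2 (measurable_comp_iterate_step p t _ (HaltedIn p E))

theorem measurableSet_exists_haltsWith (p : Program) (E : ℕ → ℕ → Prop) :
    MeasurableSet {ω | ∃ n f c, HaltsWith p ω n f c ∧ E n c} := by
  simp_rw [exists_haltsWith_iff, Set.ofPred_exists]
  exact MeasurableSet.iUnion fun t => measurableSet_haltedIn_run p E t

theorem run_cost_le (p : Program) (ω : Source) (t : ℕ) :
    (run p ω t).flips + (run p ω t).calls ≤ t := by
  induction t with
  | zero => simp [run, Config.init]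
  | succ t ih =>
    have := step_le p ω (run p ω t)
    rw [run_succ]
    omega

/-- Halted configurations are fixed by `step`, so the event is an increasing union over time. At
each time Markov's inequality applies to the supermartingale `Φ`. -/
theorem measure_haltsWith_le {p : Program} {q : ℕ → unitInterval} {E : ℕ → ℕ → Prop}
    {Inv : Config → Prop} {Φ : Config → ℝ} (hinit : Inv Config.init)
    (hstep : ∀ ω k, Inv k → Inv (step p ω k)) (hΦ : ∀ k, Inv k → 0 ≤ Φ k)
    (hmean : ∀ k, Inv k → mean p q Φ k ≤ Φ k)
    (hE : ∀ k, Inv k → HaltedIn p E k → 1 ≤ Φ k) :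
    variableSource q {ω | ∃ n f c, HaltsWith p ω n f c ∧ E n c} ≤
      ENNReal.ofReal (Φ Config.init) := by
  simp_rw [exists_haltsWith_iff, Set.ofPred_exists]
  have hInv (t : ℕ) (ω : Source) : Inv (run p ω t) := by
    induction t with
    | zero => exact hinit
    | succ t ih => rw [run_succ]; exact hstep _ _ ih
  have hmono : Monotone fun t => {ω | HaltedIn p E (run p ω t)} := by
    refine monotone_nat_of_le_succ fun t ω h => ?_
    obtain ⟨r, h1, h2⟩ := h
    simp only [Set.mem_ofPred_eq]
    rw [run_succ, step_of_halted h1]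
    exact ⟨r, h1, h2⟩
  rw [hmono.measure_iUnion]
  refine iSup_le fun t => ?_
  have h1 := lintegral_iterate_le (ρ := 1) zero_le_one hΦ hstep (q := q) (by simpa using hmean)
    t Config.init hinit
  rw [one_pow, one_mul] at h1
  refine le_trans ?_ h1
  exact meas_le_lintegral₀
    (measurable_comp_iterate_step p t _ fun k => ENNReal.ofReal (Φ k)).aemeasurable
    fun ω h => ENNReal.one_le_ofReal.2 (hE _ (hInv t ω) h)

/-- The upper bound holds for `E` with `Φ` and for its negation with `1 - Φ`. Halting makes the two
probabilities add up to at least `1`, which forces equality in both bounds. -/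
theorem measure_haltsWith_eq {p : Program} {q : ℕ → unitInterval} {E : ℕ → ℕ → Prop}
    {Inv : Config → Prop} {Φ : Config → ℝ} (hinit : Inv Config.init)
    (hstep : ∀ ω k, Inv k → Inv (step p ω k)) (hΦ : ∀ k, Inv k → 0 ≤ Φ k)
    (hΦ' : ∀ k, Inv k → Φ k ≤ 1) (hmean : ∀ k, Inv k → mean p q Φ k = Φ k)
    (hE : ∀ k, Inv k → HaltedIn p E k → Φ k = 1)
    (hE' : ∀ k, Inv k → HaltedIn p (fun n c => ¬ E n c) k → Φ k = 0)
    (hhalt : ∀ᵐ ω ∂variableSource q, ∃ n f c, HaltsWith p ω n f c) :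
    variableSource q {ω | ∃ n f c, HaltsWith p ω n f c ∧ E n c} =
      ENNReal.ofReal (Φ Config.init) := by
  have h1 := measure_haltsWith_le hinit hstep hΦ (fun k hk => (hmean k hk).le)
    fun k hk h => (hE k hk h).ge
  have hmean' (k) (hk : Inv k) : mean p q (fun k => 1 - Φ k) k ≤ 1 - Φ k := by
    rw [← hmean k hk]
    simp only [mean, Fintype.sum_bool]
    have a1 : weight half false = 1 - weight half true := by linarith [sum_weight half]
    have a2 : weight (q k.calls) false = 1 - weight (q k.calls) true := by
      linarith [sum_weight (q k.calls)]
    rw [a1, a2]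
    exact le_of_eq (by ring)
  have h2 := measure_haltsWith_le (p := p) (q := q) (E := fun n c => ¬ E n c)
    (Φ := fun k => 1 - Φ k) hinit hstep (fun k hk => sub_nonneg.2 (hΦ' k hk)) hmean'
    fun k hk h => by simp [hE' k hk h]
  refine le_antisymm h1 ?_
  have hle : (1 : ENNReal) ≤ variableSource q {ω | ∃ n f c, HaltsWith p ω n f c ∧ E n c} +
      variableSource q {ω | ∃ n f c, HaltsWith p ω n f c ∧ ¬ E n c} := by
    rw [← measure_univ (μ := variableSource q)]
    refine le_trans (measure_mono_ae ?_) (measure_union_le _ _)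
    filter_upwards [hhalt] with ω ⟨n, f, c, h⟩ _
    by_cases hE : E n c
    · exact Or.inl ⟨n, f, c, h, hE⟩
    · exact Or.inr ⟨n, f, c, h, hE⟩
  have h0 := hΦ _ hinit
  have h0' := hΦ' _ hinit
  have h3 := hle.trans (add_le_add_right h2 _)
  have hone : (1 : ENNReal) =
      ENNReal.ofReal (Φ Config.init) + ENNReal.ofReal (1 - Φ Config.init) := by
    rw [← ENNReal.ofReal_add h0 (sub_nonneg.2 h0')]
    simp
  rw [hone] at h3
  exact (ENNReal.add_le_add_iff_right ENNReal.ofReal_ne_top).1 h3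

/-- A Lyapunov function for the running time: outside `ret` it is at least `1`, and one step
decreases it in the mean by a constant factor. -/
def DecaysGeometrically (p : Program) : Prop :=
  ∀ lam : unitInterval, 0 < lam → lam < 1 →
    ∃ (Inv : Config → Prop) (V : Config → ℝ) (ρ : ℝ), 0 ≤ ρ ∧ ρ < 1 ∧ Inv Config.init ∧
      (∀ ω k, Inv k → Inv (step p ω k)) ∧
      ∀ k, Inv k → 0 ≤ V k ∧ (¬ HaltedIn p (fun _ _ => True) k → 1 ≤ V k) ∧
        mean p (fun _ => lam) V k ≤ ρ * V k

/-- A step costs at most one flip or call, so a run whose cost is not at most `m` has not halted at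
time `m`. There `V ≥ 1`, and Markov's inequality applies. -/
theorem DecaysGeometrically.tail {p : Program} (hp : DecaysGeometrically p) (lam : unitInterval)
    (h0 : 0 < lam) (h1 : lam < 1) :
    ∃ K ρ : ℝ, 0 ≤ ρ ∧ ρ < 1 ∧ ∀ m : ℕ,
      source lam {ω | ¬ ∃ n f c, HaltsWith p ω n f c ∧ f + c ≤ m} ≤
        ENNReal.ofReal (K * ρ ^ m) := by
  obtain ⟨Inv, V, ρ, hρ, hρ', hinit, hstep, hV⟩ := hp lam h0 h1
  refine ⟨V Config.init, ρ, hρ, hρ', fun m => ?_⟩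
  have h := lintegral_iterate_le hρ (fun k hk => (hV k hk).1) hstep
    (fun k hk => (hV k hk).2.2) m Config.init hinit
  rw [mul_comm] at h
  have hInv (t : ℕ) (ω : Source) : Inv (run p ω t) := by
    induction t with
    | zero => exact hinit
    | succ t ih => rw [run_succ]; exact hstep _ _ ih
  calc _ ≤ variableSource (fun _ => lam) {ω | ¬ HaltedIn p (fun _ _ => True) (run p ω m)} := by
        rw [source_eq_variableSource]
        refine measure_mono fun ω hω hh => hω ?_
        obtain ⟨r, h, -⟩ := hh
        exact ⟨_, _, _, ⟨m, r, h, rfl, rfl, rfl⟩, run_cost_le p ω m⟩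
    _ ≤ ∫⁻ ω, ENNReal.ofReal (V ((step p ω)^[m] Config.init)) ∂variableSource fun _ => lam := by
        exact meas_le_lintegral₀
          (measurable_comp_iterate_step p m _ fun k => ENNReal.ofReal (V k)).aemeasurable
          fun ω h => ENNReal.one_le_ofReal.2 ((hV _ (hInv m ω)).2.1 h)
    _ ≤ _ := h

theorem DecaysGeometrically.ae_halts {p : Program} (hp : DecaysGeometrically p)
    (lam : unitInterval) (h0 : 0 < lam) (h1 : lam < 1) :
    ∀ᵐ ω ∂source lam, ∃ n f c, HaltsWith p ω n f c := by
  obtain ⟨K, ρ, hρ, hρ', h⟩ := hp.tail lam h0 h1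
  rw [ae_iff]
  have hlim : Filter.Tendsto (fun m : ℕ => ENNReal.ofReal (K * ρ ^ m)) Filter.atTop
      (nhds 0) := by
    have := ENNReal.tendsto_ofReal ((tendsto_pow_atTop_nhds_zero_of_lt_one hρ hρ').const_mul K)
    simpa using this
  refine le_antisymm (ge_of_tendsto' hlim fun m => le_trans (measure_mono ?_) (h m)) zero_le
  rintro ω hω ⟨n, f, c, h, -⟩
  exact hω ⟨n, f, c, h⟩

/-- The probability of every event about output and number of calls is a harmonic function, as soon
as trials of size `n` succeed with probability `e n`: `D N c` is the value when a trial has drawn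
`N` successes so far and `c` calls have been made, `win n c` the value of halting. -/
def HasTrialValue (p : Program) (e : ℕ → ℝ) : Prop :=
  ∀ (q : ℕ → unitInterval) (D win : ℕ → ℕ → ℝ),
    (∀ N c, 0 ≤ D N c ∧ D N c ≤ 1) → (∀ N c, 0 ≤ win N c ∧ win N c ≤ 1) →
    (∀ N c, D N c = q c * D (N + 1) (c + 1) +
      (1 - q c) * (e N * win N (c + 1) + (1 - e N) * D 0 (c + 1))) →
    ∃ (Inv : Config → Prop) (Φ : Config → ℝ), Inv Config.init ∧ Φ Config.init = D 0 0 ∧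
      (∀ ω k, Inv k → Inv (step p ω k)) ∧
      ∀ k, Inv k → 0 ≤ Φ k ∧ Φ k ≤ 1 ∧ mean p q Φ k = Φ k ∧
        ∀ r, p[k.pc]? = some (Instr.ret r) → Φ k = win (k.counter r) k.calls

open Classical in
theorem HasTrialValue.measure_haltsWith {p : Program} {e : ℕ → ℝ} (hp : HasTrialValue p e)
    (q : ℕ → unitInterval) (E : ℕ → ℕ → Prop) (D : ℕ → ℕ → ℝ)
    (hD : ∀ N c, 0 ≤ D N c ∧ D N c ≤ 1)
    (hrec : ∀ N c, D N c = q c * D (N + 1) (c + 1) +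
      (1 - q c) * (e N * (if E N (c + 1) then 1 else 0) + (1 - e N) * D 0 (c + 1)))
    (hhalt : ∀ᵐ ω ∂variableSource q, ∃ n f c, HaltsWith p ω n f c) :
    variableSource q {ω | ∃ n f c, HaltsWith p ω n f c ∧ E n c} = ENNReal.ofReal (D 0 0) := by
  obtain ⟨Inv, Φ, hinit, hΦ0, hstep, hΦ⟩ := hp q D (fun N c => if E N c then 1 else 0) hD
    (fun N c => by split_ifs <;> norm_num) hrec
  rw [← hΦ0]
  refine measure_haltsWith_eq hinit hstep (fun k hk => (hΦ k hk).1) (fun k hk => (hΦ k hk).2.1)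
    (fun k hk => (hΦ k hk).2.2.1) (fun k hk => ?_) (fun k hk => ?_) hhalt
  · rintro ⟨r, h, hE⟩
    rw [(hΦ k hk).2.2.2 r h, if_pos hE]
  · rintro ⟨r, h, hE⟩
    rw [(hΦ k hk).2.2.2 r h, if_neg hE]

/-! ### Averages over dyadic intervals -/

/-- The left end of the dyadic interval of the numbers whose binary expansion begins with `s`. -/
noncomputable def leftEnd : List Bool → ℝ
  | [] => 0
  | b :: s => ((if b then 1 else 0) + leftEnd s) / 2

/-- The length of the dyadic intervals given by `i` bits. -/
noncomputable def width (i : ℕ) : ℝ := (1 / 2) ^ i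

theorem width_pos (i : ℕ) : 0 < width i := by unfold width; positivity

theorem width_zero : width 0 = 1 := pow_zero _

theorem width_succ (i : ℕ) : width (i + 1) = width i / 2 := by
  rw [width, pow_succ, width]; ring

theorem leftEnd_append (s t : List Bool) :
    leftEnd (s ++ t) = leftEnd s + width s.length * leftEnd t := by
  induction s with
  | nil => simp [leftEnd, width]
  | cons b s ih => simp only [List.cons_append, leftEnd, ih, List.length_cons, width_succ]; ring

theorem leftEnd_concat (s : List Bool) (b : Bool) :
    leftEnd (s ++ [b]) = leftEnd s + width s.length * ((if b then 1 else 0) / 2) := by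
  rw [leftEnd_append]; simp [leftEnd]

theorem leftEnd_nonneg (s : List Bool) : 0 ≤ leftEnd s := by
  induction s with
  | nil => simp [leftEnd]
  | cons b s ih => unfold leftEnd; positivity

theorem leftEnd_add_width_le (s : List Bool) : leftEnd s + width s.length ≤ 1 := by
  induction s with
  | nil => simp [leftEnd, width]
  | cons b s ih =>
    simp only [leftEnd, List.length_cons, width_succ]
    split_ifs <;> linarith

theorem leftEnd_take_le (s : List Bool) (i : ℕ) : leftEnd (s.take i) ≤ leftEnd s := by
  conv_rhs => rw [← List.take_append_drop i s, leftEnd_append]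
  have := mul_nonneg (width_pos (s.take i).length).le (leftEnd_nonneg (s.drop i))
  linarith

theorem rightEnd_le_take {s : List Bool} {i : ℕ} (hi : i ≤ s.length) :
    leftEnd s + width s.length ≤ leftEnd (s.take i) + width i := by
  have h1 : leftEnd s = leftEnd (s.take i) + width i * leftEnd (s.drop i) := by
    conv_lhs => rw [← List.take_append_drop i s, leftEnd_append, List.length_take_of_le hi]
  have h2 : width s.length = width i * width (s.drop i).length := by
    rw [List.length_drop, width, width, width, ← pow_add, Nat.add_sub_cancel' hi]
  have h3 := mul_le_mul_of_nonneg_left (leftEnd_add_width_le (s.drop i)) (width_pos i).le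
  rw [h1, h2]
  linarith

theorem rightEnd_take_le_one {s : List Bool} {i : ℕ} (hi : i ≤ s.length) :
    leftEnd (s.take i) + width i ≤ 1 := by
  have := leftEnd_add_width_le (s.take i)
  rwa [List.length_take_of_le hi] at this

theorem take_succ_of_getElem? {s : List Bool} {i : ℕ} {b : Bool} (h : s[i]? = some b) :
    s.take (i + 1) = s.take i ++ [b] := by
  rw [List.take_add_one, h]; rfl

theorem lt_length_of_getElem? {s : List Bool} {i : ℕ} {b : Bool} (h : s[i]? = some b) :
    i < s.length := by
  by_contra hc
  rw [List.getElem?_eq_none (not_lt.1 hc)] at h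
  exact absurd h (by simp)

theorem leftEnd_take_succ {s : List Bool} {i : ℕ} {b : Bool} (h : s[i]? = some b) :
    leftEnd (s.take (i + 1)) = leftEnd (s.take i) + width i * ((if b then 1 else 0) / 2) := by
  rw [take_succ_of_getElem? h, leftEnd_concat,
    List.length_take_of_le (lt_length_of_getElem? h).le]

/-- The average of `f` over the dyadic interval given by `s`. -/
noncomputable def average (f : ℝ → ℝ) (s : List Bool) : ℝ :=
  (∫ u in leftEnd s..leftEnd s + width s.length, f u) / width s.length

/-- `average f s` is the conditional mean of `f U` given the leading bits `s` of a uniform `U`; this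
is its martingale property when one more bit is generated. -/
theorem average_split {f : ℝ → ℝ} (hf : Continuous f) (s : List Bool) :
    average f s = (average f (s ++ [false]) + average f (s ++ [true])) / 2 := by
  have hw := width_pos s.length
  simp only [average, leftEnd_concat, List.length_append, List.length_singleton, width_succ,
    if_true, Bool.false_eq_true, if_false, zero_div, mul_zero, add_zero]
  have e1 : leftEnd s + width s.length * (1 / 2) = leftEnd s + width s.length / 2 := by ring
  have e2 : leftEnd s + width s.length / 2 + width s.length / 2 =
    leftEnd s + width s.length := by ring
  rw [e1, e2, ← add_div, intervalIntegral.integral_add_adjacent_intervals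
    (hf.intervalIntegrable _ _) (hf.intervalIntegrable _ _)]
  field_simp

theorem average_nonneg {f : ℝ → ℝ} {s : List Bool}
    (h : ∀ u ∈ Set.Icc (leftEnd s) (leftEnd s + width s.length), 0 ≤ f u) : 0 ≤ average f s :=
  div_nonneg (intervalIntegral.integral_nonneg (by linarith [width_pos s.length]) h)
    (width_pos _).le

theorem average_const (a : ℝ) (s : List Bool) : average (fun _ => a) s = a := by
  have := (width_pos s.length).ne'
  simp only [average, intervalIntegral.integral_const, add_sub_cancel_left, smul_eq_mul]
  field_simp

theorem average_sub {f g : ℝ → ℝ} (hf : Continuous f) (hg : Continuous g) (s : List Bool) :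
    average (fun u => f u - g u) s = average f s - average g s := by
  simp only [average]
  rw [intervalIntegral.integral_sub (hf.intervalIntegrable _ _) (hg.intervalIntegrable _ _),
    sub_div]

theorem average_const_mul (a : ℝ) (f : ℝ → ℝ) (s : List Bool) :
    average (fun u => a * f u) s = a * average f s := by
  simp only [average, intervalIntegral.integral_const_mul, mul_div_assoc]

theorem average_le_one {f : ℝ → ℝ} (hf : Continuous f) {s : List Bool}
    (h : ∀ u ∈ Set.Icc (leftEnd s) (leftEnd s + width s.length), f u ≤ 1) : average f s ≤ 1 := by
  have := average_nonneg (f := fun u => 1 - f u) (s := s) fun u hu => sub_nonneg.2 (h u hu)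
  rw [average_sub continuous_const hf, average_const] at this
  linarith

/-! ### The value function of the sorted machine -/

/-- The probability that `m` uniform variables are sorted and all larger than `u`. -/
noncomputable def sortedTail (m : ℕ) (u : ℝ) : ℝ := (1 - u) ^ m / m.factorial

theorem continuous_sortedTail (m : ℕ) : Continuous (sortedTail m) := by
  unfold sortedTail; fun_prop

theorem sortedTail_zero : sortedTail 0 = fun _ => 1 := by
  ext; simp [sortedTail]

theorem sortedTail_nonneg (m : ℕ) {u : ℝ} (hu : u ≤ 1) : 0 ≤ sortedTail m u :=
  div_nonneg (pow_nonneg (sub_nonneg.2 hu) _) (by positivity)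

theorem sortedTail_le_one (m : ℕ) {u : ℝ} (h0 : 0 ≤ u) (h1 : u ≤ 1) : sortedTail m u ≤ 1 := by
  rw [sortedTail, div_le_one (by positivity)]
  have : (1 : ℝ) ≤ m.factorial := by exact_mod_cast m.factorial_pos
  exact (pow_le_one₀ (by linarith) (by linarith)).trans this

theorem integral_sortedTail (m : ℕ) (a b : ℝ) :
    ∫ u in a..b, sortedTail m u = sortedTail (m + 1) a - sortedTail (m + 1) b := by
  have h (x : ℝ) : HasDerivAt (fun u => -sortedTail (m + 1) u) (sortedTail m x) x := by
    have h1 := ((((hasDerivAt_id x).const_sub 1).pow (m + 1)).div_const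
      ((m + 1).factorial : ℝ)).neg
    refine h1.congr_deriv ?_
    have : ((m + 1 : ℕ) : ℝ) ≠ 0 := by positivity
    have : (m.factorial : ℝ) ≠ 0 := by positivity
    simp only [sortedTail, Nat.factorial_succ, Nat.cast_mul, Nat.add_sub_cancel, id]
    field_simp
  rw [intervalIntegral.integral_eq_sub_of_hasDerivAt (fun x _ => h x)
    ((continuous_sortedTail m).intervalIntegrable _ _)]
  ring

theorem average_sortedTail (m : ℕ) (s : List Bool) :
    average (sortedTail m) s = (sortedTail (m + 1) (leftEnd s) -
      sortedTail (m + 1) (leftEnd s + width s.length)) / width s.length := by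
  rw [average, integral_sortedTail]

theorem sortedTail_sub_nonneg (m : ℕ) {a b : ℝ} (hab : a ≤ b) (h1 : b ≤ 1) :
    0 ≤ sortedTail (m + 1) a - sortedTail (m + 1) b := by
  rw [← integral_sortedTail]
  exact intervalIntegral.integral_nonneg hab fun u hu => sortedTail_nonneg m (hu.2.trans h1)

theorem sortedTail_sub_le (m : ℕ) {a b : ℝ} (h0 : 0 ≤ a) (hab : a ≤ b) (h1 : b ≤ 1) :
    sortedTail (m + 1) a - sortedTail (m + 1) b ≤ b - a := by
  rw [← integral_sortedTail]
  calc _ ≤ ∫ _ in a..b, (1 : ℝ) :=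
        intervalIntegral.integral_mono_on hab ((continuous_sortedTail m).intervalIntegrable _ _)
          intervalIntegrable_const fun u hu =>
            sortedTail_le_one m (h0.trans hu.1) (hu.2.trans h1)
    _ = b - a := by simp

/-- The probability of success while the next entry is compared: it agrees with the last one in the
first `i` bits, and `m` further entries are left. -/
noncomputable def sortedCompare (m i : ℕ) (s : List Bool) : ℝ :=
  (average (sortedTail (m + 1)) s - sortedTail (m + 1) (leftEnd (s.take i) + width i)) / width i

/-- Let `d` be the right end of the interval of the common prefix, of length `width i`, in which the
next entry is uniform. Given the last entry `u`, success means that the next entry `v` lies in `[u,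
d]` and the others are sorted above `v`. The probability is the integral of `sortedTail m` over `[u,
d]` divided by `width i`, by `integral_sortedTail` a difference of two values of `sortedTail (m +
1)`. Averaging over `u` gives `sortedCompare`, and the bounds hold pointwise in `u`. -/
theorem sortedCompare_mem {m i : ℕ} {s : List Bool} (hi : i ≤ s.length) :
    0 ≤ sortedCompare m i s ∧ sortedCompare m i s ≤ 1 := by
  have hw := width_pos i
  set d := leftEnd (s.take i) + width i with hd
  have hcont := continuous_sortedTail (m + 1)
  have h1 : d ≤ 1 := rightEnd_take_le_one hi
  have h2 := rightEnd_le_take hi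
  have h3 := leftEnd_take_le s i
  have e : sortedCompare m i s =
      average (fun u => (width i)⁻¹ * (sortedTail (m + 1) u - sortedTail (m + 1) d)) s := by
    rw [average_const_mul, average_sub hcont continuous_const, average_const, sortedCompare,
      div_eq_inv_mul]
  rw [e]
  refine ⟨average_nonneg fun u hu => mul_nonneg (by positivity)
    (sortedTail_sub_nonneg m (hu.2.trans h2) h1), average_le_one (by fun_prop) fun u hu => ?_⟩
  rw [inv_mul_le_one₀ hw]
  have := sortedTail_sub_le m ((leftEnd_nonneg s).trans hu.1) (hu.2.trans h2) h1
  linarith [hu.1]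

theorem average_sortedTail_mem (m : ℕ) (s : List Bool) :
    0 ≤ average (sortedTail m) s ∧ average (sortedTail m) s ≤ 1 :=
  ⟨average_nonneg fun _ hu => sortedTail_nonneg m (hu.2.trans (leftEnd_add_width_le s)),
    average_le_one (continuous_sortedTail m) fun _ hu =>
      sortedTail_le_one m ((leftEnd_nonneg s).trans hu.1) (hu.2.trans (leftEnd_add_width_le s))⟩

theorem average_sortedTail_nil (m : ℕ) :
    average (sortedTail m) [] = ((m + 1).factorial : ℝ)⁻¹ := by
  simp [average_sortedTail, leftEnd, width_zero, sortedTail]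

theorem average_sortedTail_zero (s : List Bool) : average (sortedTail 0) s = 1 := by
  rw [sortedTail_zero, average_const]

theorem sortedCompare_zero (m : ℕ) (s : List Bool) :
    sortedCompare m 0 s = average (sortedTail (m + 1)) s := by
  simp [sortedCompare, leftEnd, width_zero, sortedTail]

theorem sortedCompare_length (m : ℕ) (s : List Bool) :
    sortedCompare m s.length s =
      (sortedCompare m s.length (s ++ [false]) + sortedCompare m s.length (s ++ [true])) / 2 := by
  simp only [sortedCompare, List.take_left', List.take_length]
  rw [average_split (continuous_sortedTail _)]
  ring

/-- Against a bit `0`, a bit `1` makes the new entry larger and leaves it uniform on the right half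
of the common interval; a bit `0` prolongs the agreement. -/
theorem sortedCompare_false (m : ℕ) {i : ℕ} {s : List Bool} (h : s[i]? = some false) :
    sortedCompare m i s =
      (average (sortedTail m) (s.take i ++ [true]) + sortedCompare m (i + 1) s) / 2 := by
  have hw := (width_pos i).ne'
  have hl := List.length_take_of_le (lt_length_of_getElem? h).le
  rw [average_sortedTail]
  simp only [sortedCompare, leftEnd_take_succ h, leftEnd_concat, List.length_append, hl,
    List.length_singleton, width_succ, if_true, Bool.false_eq_true, if_false]
  have e1 : leftEnd (s.take i) + width i * (1 / 2) + width i / 2 =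
    leftEnd (s.take i) + width i := by ring
  have e2 : leftEnd (s.take i) + width i * (0 / 2) + width i / 2 =
    leftEnd (s.take i) + width i * (1 / 2) := by ring
  rw [e1, e2]
  field_simp
  ring

/-- Against a bit `1`, a bit `0` loses the trial, so only the prolonged agreement contributes. -/
theorem sortedCompare_true (m : ℕ) {i : ℕ} {s : List Bool} (h : s[i]? = some true) :
    sortedCompare m i s = sortedCompare m (i + 1) s / 2 := by
  have hw := (width_pos i).ne'
  simp only [sortedCompare, leftEnd_take_succ h, width_succ, if_true]
  have e1 : leftEnd (s.take i) + width i * (1 / 2) + width i / 2 =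
    leftEnd (s.take i) + width i := by ring
  rw [e1]
  field_simp

/-- What the registers of the sorted machine satisfy at each label. -/
def sortedInv (k : Config) : Prop :=
  match k.pc with
  | 0 | 9 | 10 | 21 | 22 | 24 | 27 => True
  | 1 => k.counter 0 = 0
  | 2 => k.counter 0 = 0 ∧ k.counter 1 = 0
  | 3 | 4 | 5 | 7 | 8 => k.counter 1 = k.counter 0 ∧ k.string 0 = []
  | 6 => k.counter 1 + 1 = k.counter 0 ∧ k.string 0 = []
  | 11 | 19 | 26 => k.counter 2 ≤ (k.string 0).length
  | 12 | 13 | 15 => k.counter 2 = (k.string 0).length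
  | 14 | 16 => k.counter 2 < (k.string 0).length
  | 17 | 18 | 20 => (k.string 0)[k.counter 2]? = some false
  | 23 | 25 => (k.string 0)[k.counter 2]? = some true
  | _ => False

/-- The value of a configuration in which the current trial succeeds with probability `S`. -/
def mixValue (D win : ℕ → ℕ → ℝ) (k : Config) (S : ℝ) : ℝ :=
  S * win (k.counter 0) k.calls + (1 - S) * D 0 k.calls

theorem mixValue_mem {D win : ℕ → ℕ → ℝ} (hD : ∀ N c, 0 ≤ D N c ∧ D N c ≤ 1)
    (hw : ∀ N c, 0 ≤ win N c ∧ win N c ≤ 1) (k : Config) {S : ℝ} (hS : 0 ≤ S ∧ S ≤ 1) :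
    0 ≤ mixValue D win k S ∧ mixValue D win k S ≤ 1 := by
  obtain ⟨h1, h2⟩ := hD 0 k.calls
  obtain ⟨h3, h4⟩ := hw (k.counter 0) k.calls
  unfold mixValue
  constructor <;> nlinarith

/-- While `N` is being drawn the value is `D`; afterwards it is the mixture of accepting and
restarting given by the success probability of the trial at that label. The default branch serves
the `ret` at label `27`. -/
noncomputable def sortedValue (D win : ℕ → ℕ → ℝ) (k : Config) : ℝ :=
  match k.pc with
  | 0 | 24 => D 0 k.calls
  | 1 | 2 | 3 | 6 | 7 => D (k.counter 0) k.calls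
  | 5 => D (k.counter 0 + 1) k.calls
  | 4 | 8 => mixValue D win k ((k.counter 0).factorial : ℝ)⁻¹
  | 9 | 22 => mixValue D win k (average (sortedTail (k.counter 1)) (k.string 0))
  | 10 => mixValue D win k (average (sortedTail (k.counter 1 + 1)) (k.string 0))
  | 11 | 12 | 14 | 16 | 17 | 19 | 23 | 26 =>
      mixValue D win k (sortedCompare (k.counter 1) (k.counter 2) (k.string 0))
  | 13 => mixValue D win k (sortedCompare (k.counter 1) (k.counter 2) (k.string 0 ++ [false]))
  | 15 => mixValue D win k (sortedCompare (k.counter 1) (k.counter 2) (k.string 0 ++ [true]))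
  | 18 | 25 => mixValue D win k (sortedCompare (k.counter 1) (k.counter 2 + 1) (k.string 0))
  | 20 => mixValue D win k
      (average (sortedTail (k.counter 1)) ((k.string 0).take (k.counter 2) ++ [true]))
  | 21 => mixValue D win k (average (sortedTail (k.counter 1)) (k.string 0 ++ [true]))
  | _ => win (k.counter 0) k.calls

theorem sortedInv_pc_le {k : Config} (h : sortedInv k) : k.pc ≤ 27 := by
  by_contra hc
  obtain ⟨d, hd⟩ := Nat.exists_eq_add_of_le (not_le.1 hc)
  simp [sortedInv, hd, add_comm] at h

theorem sortedInv_step (a b : Bool) (k : Config) (h : sortedInv k) :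
    sortedInv (step sortedMachine (constSource a b) k) := by
  have hpc := sortedInv_pc_le h
  obtain ⟨pc, ctr, str, f, c⟩ := k
  dsimp only at hpc
  interval_cases pc <;> simp [sortedInv] at h
  -- Goal `j + 1` belongs to label `j`. Goals are treated from the highest down, so that closing one
  -- does not renumber those still to come.
  on_goal 26 =>
    have := lt_length_of_getElem? h
    simp [sortedInv, step, sortedMachine, Instr.exec]
    omega
  on_goal 24 =>
    cases a <;> simp [sortedInv, step, sortedMachine, Instr.exec, h]
  on_goal 19 =>
    have := lt_length_of_getElem? h
    simp [sortedInv, step, sortedMachine, Instr.exec]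
    omega
  on_goal 18 =>
    cases a <;> simp [sortedInv, step, sortedMachine, Instr.exec, h]
  on_goal 17 =>
    simpa [sortedInv, step, sortedMachine, Instr.exec] using h.le
  on_goal 15 =>
    simpa [sortedInv, step, sortedMachine, Instr.exec] using h.le
  on_goal 13 =>
    cases a <;> simp [sortedInv, step, sortedMachine, Instr.exec, h]
  on_goal 12 =>
    rcases hr : (str 0)[ctr 2]? with _ | _ | _ <;>
      simp [sortedInv, step, sortedMachine, Instr.exec, hr]
    have := List.getElem?_eq_none_iff.1 hr
    omega
  on_goal 10 =>
    by_cases hm : ctr 1 = 0 <;> simp [sortedInv, step, sortedMachine, Instr.exec, hm]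
  on_goal 9 =>
    by_cases hm : ctr 1 = 0 <;> simp [sortedInv, step, sortedMachine, Instr.exec, hm]
  on_goal 4 =>
    cases b <;> simpa [sortedInv, step, sortedMachine, Instr.exec] using h
  all_goals simp [sortedInv, step, sortedMachine, Instr.exec, h]

theorem mean_sortedValue (q : ℕ → unitInterval) (D win : ℕ → ℕ → ℝ)
    (hrec : ∀ N c, D N c = q c * D (N + 1) (c + 1) + (1 - q c) *
      ((N.factorial : ℝ)⁻¹ * win N (c + 1) + (1 - (N.factorial : ℝ)⁻¹) * D 0 (c + 1)))
    (k : Config) (h : sortedInv k) :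
    mean sortedMachine q (sortedValue D win) k = sortedValue D win k := by
  have hpc := sortedInv_pc_le h
  obtain ⟨pc, ctr, str, f, c⟩ := k
  dsimp only at hpc
  rw [mean_eq]
  interval_cases pc <;> simp [sortedInv] at h
  on_goal 24 =>
    simp [sortedValue, step, sortedMachine, Instr.exec, mixValue]
    rw [sortedCompare_true _ h]
    ring
  on_goal 18 =>
    simp [sortedValue, step, sortedMachine, Instr.exec, mixValue]
    rw [sortedCompare_false _ h]
    ring
  on_goal 13 =>
    simp [sortedValue, step, sortedMachine, Instr.exec, h, mixValue]
    rw [sortedCompare_length]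
    ring
  on_goal 12 =>
    rcases hr : (str 0)[ctr 2]? with _ | _ | _ <;>
      simp [sortedValue, step, sortedMachine, Instr.exec, hr, mixValue] <;> ring
  on_goal 10 =>
    by_cases hm : ctr 1 = 0
    · simp [sortedValue, step, sortedMachine, Instr.exec, mixValue, hm, average_sortedTail_zero]
      ring
    · simp [sortedValue, step, sortedMachine, Instr.exec, mixValue, hm]
      rw [Nat.sub_add_cancel (Nat.pos_of_ne_zero hm)]
      ring
  -- At label `8` the size is final and nothing is known about the first entry. Its average over
  -- `[0, 1]` with `N - 1` entries left is `1 / N!`, the success probability expected there.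
  on_goal 9 =>
    by_cases hm : ctr 1 = 0
    · simp [sortedValue, step, sortedMachine, Instr.exec, mixValue, hm, ← h.1]
      ring
    · simp [sortedValue, step, sortedMachine, Instr.exec, mixValue, hm, h.2]
      rw [h.1] at hm ⊢
      rw [average_sortedTail_nil, Nat.sub_add_cancel (Nat.pos_of_ne_zero hm)]
      ring
  on_goal 4 =>
    simp [sortedValue, step, sortedMachine, Instr.exec, mixValue]
    rw [hrec (ctr 0)]
  all_goals
    simp [sortedValue, step, sortedMachine, Instr.exec, h, mixValue, sortedCompare_zero]
    try ring

theorem sortedValue_mem {D win : ℕ → ℕ → ℝ} (hD : ∀ N c, 0 ≤ D N c ∧ D N c ≤ 1)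
    (hw : ∀ N c, 0 ≤ win N c ∧ win N c ≤ 1) (k : Config) (h : sortedInv k) :
    0 ≤ sortedValue D win k ∧ sortedValue D win k ≤ 1 := by
  have hpc := sortedInv_pc_le h
  obtain ⟨pc, ctr, str, f, c⟩ := k
  dsimp only at hpc
  have hfac : (0 : ℝ) ≤ ((ctr 0).factorial : ℝ)⁻¹ ∧ ((ctr 0).factorial : ℝ)⁻¹ ≤ 1 :=
    ⟨by positivity, inv_le_one_of_one_le₀ (by exact_mod_cast (ctr 0).factorial_pos)⟩
  interval_cases pc <;> simp only [sortedInv] at h <;> simp only [sortedValue]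
  on_goal 27 =>
    exact mixValue_mem hD hw _ (sortedCompare_mem h)
  on_goal 26 =>
    exact mixValue_mem hD hw _ (sortedCompare_mem (lt_length_of_getElem? h))
  on_goal 24 =>
    exact mixValue_mem hD hw _ (sortedCompare_mem (lt_length_of_getElem? h).le)
  on_goal 23 =>
    exact mixValue_mem hD hw _ (average_sortedTail_mem _ _)
  on_goal 22 =>
    exact mixValue_mem hD hw _ (average_sortedTail_mem _ _)
  on_goal 21 =>
    exact mixValue_mem hD hw _ (average_sortedTail_mem _ _)
  on_goal 20 =>
    exact mixValue_mem hD hw _ (sortedCompare_mem h)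
  on_goal 19 =>
    exact mixValue_mem hD hw _ (sortedCompare_mem (lt_length_of_getElem? h))
  on_goal 18 =>
    exact mixValue_mem hD hw _ (sortedCompare_mem (lt_length_of_getElem? h).le)
  on_goal 17 =>
    exact mixValue_mem hD hw _ (sortedCompare_mem (by omega))
  on_goal 16 =>
    exact mixValue_mem hD hw _ (sortedCompare_mem (by simp [h]))
  on_goal 15 =>
    exact mixValue_mem hD hw _ (sortedCompare_mem (by omega))
  on_goal 14 =>
    exact mixValue_mem hD hw _ (sortedCompare_mem (by simp [h]))
  on_goal 13 =>
    exact mixValue_mem hD hw _ (sortedCompare_mem (by omega))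
  on_goal 12 =>
    exact mixValue_mem hD hw _ (sortedCompare_mem h)
  on_goal 11 =>
    exact mixValue_mem hD hw _ (average_sortedTail_mem _ _)
  on_goal 10 =>
    exact mixValue_mem hD hw _ (average_sortedTail_mem _ _)
  on_goal 9 =>
    exact mixValue_mem hD hw _ hfac
  on_goal 5 =>
    exact mixValue_mem hD hw _ hfac
  all_goals first | exact hD _ _ | exact hw _ _

theorem sortedMachine_hasTrialValue :
    HasTrialValue sortedMachine fun n => (n.factorial : ℝ)⁻¹ := by
  intro q D win hD hw hrec
  refine ⟨sortedInv, sortedValue D win, trivial, rfl, fun ω k hk => ?_, fun k hk => ?_⟩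
  · rw [step_eq_constSource]
    exact sortedInv_step _ _ k hk
  · obtain ⟨h1, h2⟩ := sortedValue_mem hD hw k hk
    refine ⟨h1, h2, mean_sortedValue q D win hrec k hk, fun r hr => ?_⟩
    have hpc := sortedInv_pc_le hk
    obtain ⟨pc, ctr, str, f, c⟩ := k
    dsimp only at hpc
    interval_cases pc <;> simp [sortedMachine] at hr
    simp [sortedValue, hr]

/-! ### The value function of the machine for permutations with largest first element -/

theorem average_pow_mem (m : ℕ) (s : List Bool) :
    0 ≤ average (fun u => u ^ m) s ∧ average (fun u => u ^ m) s ≤ 1 :=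
  ⟨average_nonneg fun _ hu => pow_nonneg ((leftEnd_nonneg s).trans hu.1) m,
    average_le_one (by fun_prop) fun _ hu => pow_le_one₀ ((leftEnd_nonneg s).trans hu.1)
      (hu.2.trans (leftEnd_add_width_le s))⟩

theorem average_pow_nil (m : ℕ) : average (fun u => u ^ m) [] = ((m + 1 : ℕ) : ℝ)⁻¹ := by
  simp [average, leftEnd, width_zero]

/-- The probability of success while a new entry is compared with the first one: they agree in
`i` bits, and `m` further entries are left. -/
noncomputable def largestCompare (m i : ℕ) (s : List Bool) : ℝ :=
  (average (fun u => u ^ (m + 1)) s - leftEnd (s.take i) * average (fun u => u ^ m) s) / width i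

/-- Given the first entry `u`, a new entry that is uniform on the common interval `[a, a + width i]`
is smaller with probability `(u - a) / width i`, and the other `m` entries are smaller with
probability `u ^ m`. `largestCompare` is the average of the product over `u`. -/
theorem largestCompare_mem {m i : ℕ} {s : List Bool} (hi : i ≤ s.length) :
    0 ≤ largestCompare m i s ∧ largestCompare m i s ≤ 1 := by
  have hw := width_pos i
  set a := leftEnd (s.take i) with ha
  have h1 : a + width i ≤ 1 := rightEnd_take_le_one hi
  have h2 := rightEnd_le_take hi
  have h3 := leftEnd_take_le s i
  have e : largestCompare m i s =
      average (fun u => (width i)⁻¹ * (u ^ (m + 1) - a * u ^ m)) s := by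
    rw [average_const_mul, average_sub (by fun_prop) (by fun_prop), average_const_mul,
      largestCompare, div_eq_inv_mul]
  have e' (u : ℝ) : u ^ (m + 1) - a * u ^ m = u ^ m * (u - a) := by ring
  rw [e]
  refine ⟨average_nonneg fun u hu => mul_nonneg (by positivity) ?_,
    average_le_one (by fun_prop) fun u hu => ?_⟩
  · rw [e']
    exact mul_nonneg (pow_nonneg ((leftEnd_nonneg s).trans hu.1) m) (by linarith [hu.1])
  · rw [inv_mul_le_one₀ hw, e']
    have hu0 := (leftEnd_nonneg s).trans hu.1
    have hu1 := hu.2.trans (leftEnd_add_width_le s)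
    calc u ^ m * (u - a) ≤ 1 * (u - a) :=
          mul_le_mul_of_nonneg_right (pow_le_one₀ hu0 hu1) (by linarith [hu.1])
      _ ≤ width i := by linarith [hu.2]

theorem largestCompare_zero (m : ℕ) (s : List Bool) :
    largestCompare m 0 s = average (fun u => u ^ (m + 1)) s := by
  simp [largestCompare, leftEnd, width_zero]

theorem largestCompare_length (m : ℕ) (s : List Bool) :
    largestCompare m s.length s =
      (largestCompare m s.length (s ++ [false]) +
        largestCompare m s.length (s ++ [true])) / 2 := by
  simp only [largestCompare, List.take_left', List.take_length]
  rw [average_split (f := fun u => u ^ (m + 1)) (by fun_prop),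
    average_split (f := fun u => u ^ m) (by fun_prop)]
  ring

theorem largestCompare_false (m : ℕ) {i : ℕ} {s : List Bool} (h : s[i]? = some false) :
    largestCompare m i s = largestCompare m (i + 1) s / 2 := by
  have hw := (width_pos i).ne'
  simp only [largestCompare, leftEnd_take_succ h, width_succ, Bool.false_eq_true, if_false,
    zero_div, mul_zero, add_zero]
  field_simp

/-- A bit `0` against a bit `1` settles this entry favourably without revealing anything about the
first entry beyond `s`, hence the plain average of `u ^ m`. -/
theorem largestCompare_true (m : ℕ) {i : ℕ} {s : List Bool} (h : s[i]? = some true) :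
    largestCompare m i s =
      (largestCompare m (i + 1) s + average (fun u => u ^ m) s) / 2 := by
  have hw := (width_pos i).ne'
  simp only [largestCompare, leftEnd_take_succ h, width_succ, if_true]
  field_simp
  ring

/-- What the registers of the machine satisfy at each label. -/
def largestInv (k : Config) : Prop :=
  match k.pc with
  | 0 | 9 | 10 | 21 | 24 => True
  | 1 => k.counter 0 = 0
  | 2 => k.counter 0 = 0 ∧ k.counter 1 = 0
  | 3 | 4 | 5 | 7 | 8 => k.counter 1 = k.counter 0 ∧ k.string 0 = []
  | 6 => k.counter 1 + 1 = k.counter 0 ∧ k.string 0 = []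
  | 11 | 19 | 23 => k.counter 2 ≤ (k.string 0).length
  | 12 | 13 | 15 => k.counter 2 = (k.string 0).length
  | 14 | 16 => k.counter 2 < (k.string 0).length
  | 17 | 18 => (k.string 0)[k.counter 2]? = some false
  | 20 | 22 => (k.string 0)[k.counter 2]? = some true
  | _ => False

noncomputable def largestValue (D win : ℕ → ℕ → ℝ) (k : Config) : ℝ :=
  match k.pc with
  | 0 => D 0 k.calls
  | 1 | 2 | 3 | 6 | 7 => D (k.counter 0) k.calls
  | 5 => D (k.counter 0 + 1) k.calls
  | 4 | 8 => mixValue D win k (k.counter 0 : ℝ)⁻¹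
  | 9 | 21 => mixValue D win k (average (fun u => u ^ k.counter 1) (k.string 0))
  | 10 => mixValue D win k (average (fun u => u ^ (k.counter 1 + 1)) (k.string 0))
  | 11 | 12 | 14 | 16 | 17 | 19 | 20 | 23 =>
      mixValue D win k (largestCompare (k.counter 1) (k.counter 2) (k.string 0))
  | 13 => mixValue D win k (largestCompare (k.counter 1) (k.counter 2) (k.string 0 ++ [false]))
  | 15 => mixValue D win k (largestCompare (k.counter 1) (k.counter 2) (k.string 0 ++ [true]))
  | 18 | 22 => mixValue D win k (largestCompare (k.counter 1) (k.counter 2 + 1) (k.string 0))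
  | _ => win (k.counter 0) k.calls

theorem largestInv_pc_le {k : Config} (h : largestInv k) : k.pc ≤ 24 := by
  by_contra hc
  obtain ⟨d, hd⟩ := Nat.exists_eq_add_of_le (not_le.1 hc)
  simp [largestInv, hd, add_comm] at h

theorem largestInv_step (a b : Bool) (k : Config) (h : largestInv k) :
    largestInv (step firstLargestMachine (constSource a b) k) := by
  have hpc := largestInv_pc_le h
  obtain ⟨pc, ctr, str, f, c⟩ := k
  dsimp only at hpc
  interval_cases pc <;> simp [largestInv] at h
  on_goal 23 =>
    have := lt_length_of_getElem? h
    simp [largestInv, step, firstLargestMachine, Instr.exec]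
    omega
  on_goal 21 =>
    cases a <;> simp [largestInv, step, firstLargestMachine, Instr.exec, h]
  on_goal 19 =>
    have := lt_length_of_getElem? h
    simp [largestInv, step, firstLargestMachine, Instr.exec]
    omega
  on_goal 18 =>
    cases a <;> simp [largestInv, step, firstLargestMachine, Instr.exec, h]
  on_goal 17 =>
    simpa [largestInv, step, firstLargestMachine, Instr.exec] using h.le
  on_goal 15 =>
    simpa [largestInv, step, firstLargestMachine, Instr.exec] using h.le
  on_goal 13 =>
    cases a <;> simp [largestInv, step, firstLargestMachine, Instr.exec, h]
  on_goal 12 =>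
    rcases hr : (str 0)[ctr 2]? with _ | _ | _ <;>
      simp [largestInv, step, firstLargestMachine, Instr.exec, hr]
    have := List.getElem?_eq_none_iff.1 hr
    omega
  on_goal 10 =>
    by_cases hm : ctr 1 = 0 <;> simp [largestInv, step, firstLargestMachine, Instr.exec, hm]
  on_goal 9 =>
    by_cases hm : ctr 1 = 0 <;> simp [largestInv, step, firstLargestMachine, Instr.exec, hm]
  on_goal 4 =>
    cases b <;> simpa [largestInv, step, firstLargestMachine, Instr.exec] using h
  all_goals simp [largestInv, step, firstLargestMachine, Instr.exec, h]

theorem mean_largestValue (q : ℕ → unitInterval) (D win : ℕ → ℕ → ℝ)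
    (hrec : ∀ N c, D N c = q c * D (N + 1) (c + 1) + (1 - q c) *
      ((N : ℝ)⁻¹ * win N (c + 1) + (1 - (N : ℝ)⁻¹) * D 0 (c + 1)))
    (k : Config) (h : largestInv k) :
    mean firstLargestMachine q (largestValue D win) k = largestValue D win k := by
  have hpc := largestInv_pc_le h
  obtain ⟨pc, ctr, str, f, c⟩ := k
  dsimp only at hpc
  rw [mean_eq]
  interval_cases pc <;> simp [largestInv] at h
  on_goal 21 =>
    simp [largestValue, step, firstLargestMachine, Instr.exec, mixValue]
    rw [largestCompare_true _ h]
    ring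
  on_goal 18 =>
    simp [largestValue, step, firstLargestMachine, Instr.exec, mixValue]
    rw [largestCompare_false _ h]
    ring
  on_goal 13 =>
    simp [largestValue, step, firstLargestMachine, Instr.exec, h, mixValue]
    rw [largestCompare_length]
    ring
  on_goal 12 =>
    rcases hr : (str 0)[ctr 2]? with _ | _ | _ <;>
      simp [largestValue, step, firstLargestMachine, Instr.exec, hr, mixValue] <;> ring
  on_goal 10 =>
    by_cases hm : ctr 1 = 0
    · simp [largestValue, step, firstLargestMachine, Instr.exec, mixValue, hm, average_const]
      ring
    · simp [largestValue, step, firstLargestMachine, Instr.exec, mixValue, hm]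
      rw [Nat.sub_add_cancel (Nat.pos_of_ne_zero hm)]
      ring
  on_goal 9 =>
    by_cases hm : ctr 1 = 0
    · simp [largestValue, step, firstLargestMachine, Instr.exec, mixValue, hm, ← h.1]
      ring
    · simp [largestValue, step, firstLargestMachine, Instr.exec, mixValue, hm, h.2]
      rw [h.1] at hm ⊢
      rw [average_pow_nil, Nat.sub_add_cancel (Nat.pos_of_ne_zero hm)]
      ring
  on_goal 4 =>
    simp [largestValue, step, firstLargestMachine, Instr.exec, mixValue]
    rw [hrec (ctr 0)]
  all_goals
    simp [largestValue, step, firstLargestMachine, Instr.exec, h, mixValue, largestCompare_zero]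
    try ring

theorem largestValue_mem {D win : ℕ → ℕ → ℝ} (hD : ∀ N c, 0 ≤ D N c ∧ D N c ≤ 1)
    (hw : ∀ N c, 0 ≤ win N c ∧ win N c ≤ 1) (k : Config) (h : largestInv k) :
    0 ≤ largestValue D win k ∧ largestValue D win k ≤ 1 := by
  have hpc := largestInv_pc_le h
  obtain ⟨pc, ctr, str, f, c⟩ := k
  dsimp only at hpc
  have hinv : (0 : ℝ) ≤ (ctr 0 : ℝ)⁻¹ ∧ (ctr 0 : ℝ)⁻¹ ≤ 1 :=
    ⟨by positivity, Nat.cast_inv_le_one _⟩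
  interval_cases pc <;> simp only [largestInv] at h <;> simp only [largestValue]
  on_goal 24 =>
    exact mixValue_mem hD hw _ (largestCompare_mem h)
  on_goal 23 =>
    exact mixValue_mem hD hw _ (largestCompare_mem (lt_length_of_getElem? h))
  on_goal 22 =>
    exact mixValue_mem hD hw _ (average_pow_mem _ _)
  on_goal 21 =>
    exact mixValue_mem hD hw _ (largestCompare_mem (lt_length_of_getElem? h).le)
  on_goal 20 =>
    exact mixValue_mem hD hw _ (largestCompare_mem h)
  on_goal 19 =>
    exact mixValue_mem hD hw _ (largestCompare_mem (lt_length_of_getElem? h))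
  on_goal 18 =>
    exact mixValue_mem hD hw _ (largestCompare_mem (lt_length_of_getElem? h).le)
  on_goal 17 =>
    exact mixValue_mem hD hw _ (largestCompare_mem (by omega))
  on_goal 16 =>
    exact mixValue_mem hD hw _ (largestCompare_mem (by simp [h]))
  on_goal 15 =>
    exact mixValue_mem hD hw _ (largestCompare_mem (by omega))
  on_goal 14 =>
    exact mixValue_mem hD hw _ (largestCompare_mem (by simp [h]))
  on_goal 13 =>
    exact mixValue_mem hD hw _ (largestCompare_mem (by omega))
  on_goal 12 =>
    exact mixValue_mem hD hw _ (largestCompare_mem h)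
  on_goal 11 =>
    exact mixValue_mem hD hw _ (average_pow_mem _ _)
  on_goal 10 =>
    exact mixValue_mem hD hw _ (average_pow_mem _ _)
  on_goal 9 =>
    exact mixValue_mem hD hw _ hinv
  on_goal 5 =>
    exact mixValue_mem hD hw _ hinv
  all_goals first | exact hD _ _ | exact hw _ _

/-- For `n = 0` the convention `0⁻¹ = 0` is exactly what is needed: an empty vector always fails. -/
theorem firstLargestMachine_hasTrialValue :
    HasTrialValue firstLargestMachine fun n => (n : ℝ)⁻¹ := by
  intro q D win hD hw hrec
  refine ⟨largestInv, largestValue D win, trivial, rfl, fun ω k hk => ?_, fun k hk => ?_⟩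
  · rw [step_eq_constSource]
    exact largestInv_step _ _ k hk
  · obtain ⟨h1, h2⟩ := largestValue_mem hD hw k hk
    refine ⟨h1, h2, mean_largestValue q D win hrec k hk, fun r hr => ?_⟩
    have hpc := largestInv_pc_le hk
    obtain ⟨pc, ctr, str, f, c⟩ := k
    dsimp only at hpc
    interval_cases pc <;> simp [firstLargestMachine] at hr
    simp [largestValue, hr]

/-! ### Lyapunov functions for the running time -/

theorem eventually_pos_nhdsGT {F : ℝ → ℝ} (hF : Continuous F) (h : 0 < F 1) :
    ∀ᶠ θ in nhdsWithin 1 (Set.Ioi 1), 0 < F θ :=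
  (hF.continuousAt.eventually_const_lt h).filter_mono nhdsWithin_le_nhds

/-- The constants scale the Lyapunov function while `N` is being drawn: `A₀` for no success yet,
`A₁` for one, `A` for the general case. At `θ = 1` all conditions on them, apart from the inequality
between powers of `θ` alone, are strict or plain bounds on the constants, so the former persist for
`θ` slightly above `1` by continuity. -/
theorem exists_lyapunov_constants {l : ℝ} (h0 : 0 < l) (h1 : l < 1) :
    ∃ θ A A₀ A₁ : ℝ, 1 < θ ∧ 1 ≤ A ∧ 1 / 4 ≤ A₀ ∧ 1 / 4 ≤ A₁ ∧ θ ^ 4 + θ ^ 21 ≤ 2 * θ ^ 13 ∧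
      θ * A₀ ≤ 1 ∧ l * (θ ^ 24 * A) + (1 - l) * (θ ^ 2 / 4) ≤ A₀ ∧
      l * (θ ^ 24 * A) + (1 - l) * θ ^ 2 ≤ A ∧ l * (θ ^ 4 * A₁) + (1 - l) * (θ ^ 6 * A₀) ≤ A₀ ∧
      l * (θ ^ 44 * A) + (1 - l) * (θ ^ 3 / 4) ≤ A₁ := by
  set A := 1 + (1 - l) / 4 with hA
  set A₀ := 1 - (1 - l) / 4 with hA₀
  set A₁ := 1 - 3 * (1 - l) / 8 with hA₁
  -- `θ ^ 4 + θ ^ 21 ≤ 2 * θ ^ 13` is an equality at `θ = 1`. Its defect is `θ ^ 4 * (θ - 1)` times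
  -- this polynomial, whose value at `1` is `9 - 8 > 0`; equivalently, `4 + 21 < 2 * 13`.
  have e1 := eventually_pos_nhdsGT
    (F := fun θ => (1 + θ + θ ^ 2 + θ ^ 3 + θ ^ 4 + θ ^ 5 + θ ^ 6 + θ ^ 7 + θ ^ 8) -
      θ ^ 9 * (1 + θ + θ ^ 2 + θ ^ 3 + θ ^ 4 + θ ^ 5 + θ ^ 6 + θ ^ 7)) (by fun_prop) (by norm_num)
  have e2 := eventually_pos_nhdsGT (F := fun θ => 1 - θ * A₀) (by fun_prop)
    (by simp only [hA₀]; linarith)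
  have e3 := eventually_pos_nhdsGT
    (F := fun θ => A₀ - (l * (θ ^ 24 * A) + (1 - l) * (θ ^ 2 / 4))) (by fun_prop)
    (by simp only [hA₀, hA]; nlinarith)
  have e4 := eventually_pos_nhdsGT
    (F := fun θ => A - (l * (θ ^ 24 * A) + (1 - l) * θ ^ 2)) (by fun_prop)
    (by simp only [hA]; nlinarith)
  have e5 := eventually_pos_nhdsGT
    (F := fun θ => A₀ - (l * (θ ^ 4 * A₁) + (1 - l) * (θ ^ 6 * A₀))) (by fun_prop)
    (by simp only [hA₀, hA₁]; nlinarith)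
  have e6 := eventually_pos_nhdsGT
    (F := fun θ => A₁ - (l * (θ ^ 44 * A) + (1 - l) * (θ ^ 3 / 4))) (by fun_prop)
    (by simp only [hA₁, hA]; nlinarith)
  obtain ⟨θ, f1, f2, f3, f4, f5, f6, hθ⟩ := (e1.and (e2.and (e3.and (e4.and (e5.and (e6.and
    self_mem_nhdsWithin)))))).exists
  have hθ' : 1 < θ := hθ
  refine ⟨θ, A, A₀, A₁, hθ', by linarith, by linarith, by linarith, ?_, by linarith, by linarith,
    by linarith, by linarith, by linarith⟩
  have := mul_nonneg (mul_nonneg (sub_nonneg.2 hθ'.le) f1.le) (by positivity : 0 ≤ θ ^ 4)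
  linarith

/-- The building block of the Lyapunov functions: every remaining entry counts as `20` steps. -/
def growth (θ C : ℝ) (e m : ℕ) : ℝ := C * θ ^ (e + 20 * m)

theorem mul_growth (θ C : ℝ) (e m : ℕ) : θ * growth θ C e m = growth θ C (e + 1) m := by
  unfold growth; ring

theorem growth_succ (θ C : ℝ) (e m : ℕ) : growth θ C e (m + 1) = growth θ C (e + 20) m := by
  unfold growth; ring_nf

theorem growth_mono {θ C C' : ℝ} {e e' m m' : ℕ} (hθ : 1 < θ) (hC : 0 ≤ C) (hC' : C ≤ C')
    (he : e + 20 * m ≤ e' + 20 * m') : growth θ C e m ≤ growth θ C' e' m' :=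
  mul_le_mul hC' (pow_le_pow_right₀ hθ.le he) (by positivity) (hC.trans hC')

theorem le_growth {θ C δ : ℝ} (e m : ℕ) (hθ : 1 < θ) (h0 : 0 ≤ C) (hC : δ ≤ C) :
    δ ≤ growth θ C e m :=
  hC.trans (le_mul_of_one_le_right h0 (one_le_pow₀ hθ.le))

/-! ### One-step drift and the Lyapunov functions of the two machines. -/

theorem mean_const_mul (p : Program) (q : ℕ → unitInterval) (a : ℝ) (V : Config → ℝ)
    (k : Config) : mean p q (fun k => a * V k) k = a * mean p q V k := by
  simp only [mean, Fintype.sum_bool]; ring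

section

variable {p : Program} {q : ℕ → unitInterval} {V : Config → ℝ} {k : Config} {θ : ℝ}

theorem mean_le_of_forall (hθ : 0 < θ)
    (h : ∀ a b, θ * V (step p (constSource a b) k) ≤ V k) : mean p q V k ≤ θ⁻¹ * V k := by
  rw [← div_eq_inv_mul, le_div_iff₀' hθ, mean_eq]
  have hq := (q k.calls).2.1
  have hq' := (q k.calls).2.2
  have h1 := mul_le_mul_of_nonneg_left (h true true) hq
  have h2 := mul_le_mul_of_nonneg_left (h true false) (sub_nonneg.2 hq')
  have h3 := mul_le_mul_of_nonneg_left (h false true) hq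
  have h4 := mul_le_mul_of_nonneg_left (h false false) (sub_nonneg.2 hq')
  linarith

theorem mean_le_of_flip (hθ : 0 < θ)
    (h : ∀ b, θ * V (step p (constSource true b) k) + θ * V (step p (constSource false b) k) ≤
      2 * V k) : mean p q V k ≤ θ⁻¹ * V k := by
  rw [← div_eq_inv_mul, le_div_iff₀' hθ, mean_eq]
  have h1 := mul_le_mul_of_nonneg_left (h true) (q k.calls).2.1
  have h2 := mul_le_mul_of_nonneg_left (h false) (sub_nonneg.2 (q k.calls).2.2)
  linarith

theorem mean_le_of_call (hθ : 0 < θ)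
    (h : ∀ a, q k.calls * (θ * V (step p (constSource a true) k)) +
      (1 - q k.calls) * (θ * V (step p (constSource a false) k)) ≤ V k) :
    mean p q V k ≤ θ⁻¹ * V k := by
  rw [← div_eq_inv_mul, le_div_iff₀' hθ, mean_eq]
  have h1 := h true
  have h2 := h false
  linarith

end

/-- In the comparison loop the exponent drops by at least one at each step other than the decisive
flip. That flip, at exponent `13`, either leaves the loop at the cost of at most `θ ^ 4` or starts
another round at the cost of `θ ^ 21`, the factor for the step included. Restarting is paid for by
`A₀ < 1`, which itself is balanced by the chance of drawing `N = 0`, when the machine accepts at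
once. -/
noncomputable def sortedLyapunov (θ A A₀ : ℝ) (k : Config) : ℝ :=
  let m := k.counter 1
  match k.pc with
  | 0 => growth θ A₀ 3 0
  | 1 => growth θ A₀ 2 0
  | 2 => growth θ A₀ 1 0
  | 3 => if m = 0 then growth θ A₀ 0 0 else growth θ A 0 m
  | 4 => if m = 0 then growth θ (1 / 4) 1 0 else growth θ 1 1 m
  | 5 => growth θ A 3 (m + 1)
  | 6 => growth θ A 2 (m + 1)
  | 7 => if m = 0 then growth θ A₀ 1 0 else growth θ A 1 m
  | 8 => if m = 0 then growth θ (1 / 4) 0 0 else growth θ 1 0 m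
  | 9 => growth θ 1 0 m
  | 10 | 19 | 26 => growth θ 1 19 m
  | 11 => if k.counter 2 < (k.string 0).length then growth θ 1 14 m else growth θ 1 18 m
  | 12 => growth θ 1 17 m
  | 13 | 15 => growth θ 1 16 m
  | 14 | 16 => growth θ 1 15 m
  | 17 | 23 => growth θ 1 13 m
  | 18 | 25 => growth θ 1 20 m
  | 20 => growth θ 1 3 m
  | 21 => growth θ 1 2 m
  | 22 => growth θ 1 1 m
  | 24 => growth θ A₀ 4 0
  | _ => 0

theorem mean_sortedLyapunov {l : unitInterval} {θ A A₀ : ℝ} (hθ : 1 < θ)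
    (hA₀ : 1 / 4 ≤ A₀) (h1 : θ ^ 4 + θ ^ 21 ≤ 2 * θ ^ 13) (h2 : θ * A₀ ≤ 1)
    (h3 : l * (θ ^ 24 * A) + (1 - l) * (θ ^ 2 / 4) ≤ A₀)
    (h4 : l * (θ ^ 24 * A) + (1 - l) * θ ^ 2 ≤ A)
    (k : Config) (h : sortedInv k) :
    mean sortedMachine (fun _ => l) (sortedLyapunov θ A A₀) k ≤
      θ⁻¹ * sortedLyapunov θ A A₀ k := by
  have hpc := sortedInv_pc_le h
  have hθ0 : 0 < θ := by linarith
  have hexit (m : ℕ) : growth θ 1 4 m + growth θ 1 21 m ≤ 2 * growth θ 1 13 m := by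
    have := mul_le_mul_of_nonneg_right h1 (by positivity : 0 ≤ θ ^ (20 * m))
    simp only [growth, pow_add]
    linarith
  obtain ⟨pc, ctr, str, f, c⟩ := k
  dsimp only at hpc
  interval_cases pc <;> simp [sortedInv] at h
  on_goal 27 =>
    refine mean_le_of_forall hθ0 fun a b => ?_
    simp [sortedLyapunov, step, sortedMachine, Instr.exec, mul_growth]
    split_ifs <;> exact growth_mono hθ (by norm_num) le_rfl (by omega)
  on_goal 24 =>
    refine mean_le_of_flip hθ0 fun b => ?_
    simp [sortedLyapunov, step, sortedMachine, Instr.exec, mul_growth]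
    -- Failure passes through the extra jump at label `24`; the condition `θ * A₀ ≤ 1` absorbs that
    -- step.
    have : growth θ A₀ 5 0 ≤ growth θ 1 4 (ctr 1) := by
      calc growth θ A₀ 5 0 = growth θ (θ * A₀) 4 0 := by simp only [growth]; ring
        _ ≤ _ := growth_mono hθ (by nlinarith) h2 (by omega)
    linarith [hexit (ctr 1)]
  on_goal 20 =>
    refine mean_le_of_forall hθ0 fun a b => ?_
    simp [sortedLyapunov, step, sortedMachine, Instr.exec, mul_growth]
    split_ifs <;> exact growth_mono hθ (by norm_num) le_rfl (by omega)
  on_goal 18 =>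
    refine mean_le_of_flip hθ0 fun b => ?_
    simp [sortedLyapunov, step, sortedMachine, Instr.exec, mul_growth]
    exact hexit _
  on_goal 13 =>
    refine mean_le_of_flip hθ0 fun b => ?_
    simp [sortedLyapunov, step, sortedMachine, Instr.exec, mul_growth]
    linarith
  on_goal 12 =>
    refine mean_le_of_forall hθ0 fun a b => ?_
    rcases hr : (str 0)[ctr 2]? with _ | _ | _
    · have := List.getElem?_eq_none_iff.1 hr
      simp [sortedLyapunov, step, sortedMachine, Instr.exec, mul_growth, not_lt.2 this]
    all_goals
      have := lt_length_of_getElem? hr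
      simp [sortedLyapunov, step, sortedMachine, Instr.exec, hr, mul_growth]
      rw [if_pos this]
  on_goal 11 =>
    refine mean_le_of_forall hθ0 fun a b => ?_
    simp [sortedLyapunov, step, sortedMachine, Instr.exec, mul_growth]
    split_ifs <;> exact growth_mono hθ (by norm_num) le_rfl (by omega)
  on_goal 10 =>
    refine mean_le_of_forall hθ0 fun a b => ?_
    by_cases hm : ctr 1 = 0
    · simp [sortedLyapunov, step, sortedMachine, Instr.exec, hm]
      exact le_growth _ _ hθ (by norm_num) (by norm_num)
    · simp [sortedLyapunov, step, sortedMachine, Instr.exec, mul_growth, hm]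
      exact growth_mono hθ (by norm_num) le_rfl (by omega)
  on_goal 9 =>
    refine mean_le_of_forall hθ0 fun a b => ?_
    by_cases hm : ctr 1 = 0
    · simp [sortedLyapunov, step, sortedMachine, Instr.exec, hm]
      exact le_growth _ _ hθ (by norm_num) (by norm_num)
    · simp [sortedLyapunov, step, sortedMachine, Instr.exec, mul_growth, hm]
      exact growth_mono hθ (by norm_num) le_rfl (by omega)
  on_goal 7 =>
    refine mean_le_of_forall hθ0 fun a b => ?_
    simp [sortedLyapunov, step, sortedMachine, Instr.exec, mul_growth]
  on_goal 4 =>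
    refine mean_le_of_call hθ0 fun a => ?_
    by_cases hm : ctr 1 = 0
    · simp [sortedLyapunov, step, sortedMachine, Instr.exec, mul_growth, growth_succ, hm]
      simp only [growth]
      linarith
    · simp [sortedLyapunov, step, sortedMachine, Instr.exec, mul_growth, growth_succ, hm]
      have := mul_le_mul_of_nonneg_right h4 (by positivity : 0 ≤ θ ^ (20 * ctr 1))
      simp only [growth, pow_add]
      linarith
  all_goals
    refine mean_le_of_forall hθ0 fun a b => ?_
    simp [sortedLyapunov, step, sortedMachine, Instr.exec, mul_growth, h]

theorem sortedLyapunov_ge {θ A A₀ : ℝ} (hθ : 1 < θ) (hA : 1 ≤ A) (hA₀ : 1 / 4 ≤ A₀)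
    (k : Config) (h : sortedInv k) (hk : k.pc ≠ 27) : 1 / 4 ≤ sortedLyapunov θ A A₀ k := by
  have hpc := sortedInv_pc_le h
  obtain ⟨pc, ctr, str, f, c⟩ := k
  dsimp only at hpc hk
  interval_cases pc <;> simp only [sortedLyapunov] <;> (try split_ifs) <;>
    first
      | exact absurd rfl hk
      | exact le_growth _ _ hθ (by linarith) (by linarith)

theorem sortedMachine_decaysGeometrically : DecaysGeometrically sortedMachine := by
  intro lam h0 h1
  obtain ⟨θ, A, A₀, A₁, hθ, hA, hA₀, -, e1, e2, e3, e4, -, -⟩ :=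
    exists_lyapunov_constants (l := lam) h0 h1
  -- The factor `4` turns the lower bound `1 / 4` outside `ret` into the required `1`.
  refine ⟨sortedInv, fun k => 4 * sortedLyapunov θ A A₀ k, θ⁻¹, by positivity,
    inv_lt_one_of_one_lt₀ hθ, trivial, fun ω k hk => ?_, fun k hk => ⟨?_, fun hh => ?_, ?_⟩⟩
  · rw [step_eq_constSource]
    exact sortedInv_step _ _ k hk
  · by_cases h : k.pc = 27
    · simp [sortedLyapunov, h]
    · have := sortedLyapunov_ge hθ hA hA₀ k hk h
      linarith
  · have := sortedLyapunov_ge hθ hA hA₀ k hk fun h => hh ⟨0, by simp [h, sortedMachine], trivial⟩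
    linarith
  · rw [mean_const_mul]
    have := mean_sortedLyapunov hθ hA₀ e1 e2 e3 e4 k hk
    linarith

/-- Here `N = 0` fails and the vector accepted without any comparison has `N = 1`. The drift of a
restart is thus gained in two stages, through the separate constant `A₁` for one success. -/
noncomputable def largestLyapunov (θ A A₀ A₁ : ℝ) (k : Config) : ℝ :=
  let m := k.counter 1
  match k.pc with
  | 0 => growth θ A₀ 3 0
  | 1 => growth θ A₀ 2 0
  | 2 => growth θ A₀ 1 0
  | 3 => if m = 0 then growth θ A₀ 0 0 else if m = 1 then growth θ A₁ 0 0 else growth θ A 0 m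
  | 4 => if m = 0 then growth θ A₀ 5 0 else if m = 1 then growth θ (1 / 4) 2 0
      else growth θ 1 1 m
  | 5 => if m = 0 then growth θ A₁ 3 0 else growth θ A 3 (m + 1)
  | 6 => if m = 0 then growth θ A₁ 2 0 else growth θ A 2 (m + 1)
  | 7 => if m = 0 then growth θ A₀ 1 0 else if m = 1 then growth θ A₁ 1 0 else growth θ A 1 m
  | 8 => if m = 0 then growth θ A₀ 4 0 else if m = 1 then growth θ (1 / 4) 1 0
      else growth θ 1 0 m
  | 9 => if m = 0 then growth θ (1 / 4) 0 0 else growth θ 1 0 m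
  | 10 | 19 | 23 => growth θ 1 19 m
  | 11 => if k.counter 2 < (k.string 0).length then growth θ 1 14 m else growth θ 1 18 m
  | 12 => growth θ 1 17 m
  | 13 | 15 => growth θ 1 16 m
  | 14 | 16 => growth θ 1 15 m
  | 17 | 20 => growth θ 1 13 m
  | 18 | 22 => growth θ 1 20 m
  | 21 => growth θ 1 1 m
  | _ => 0

theorem mean_largestLyapunov {l : unitInterval} {θ A A₀ A₁ : ℝ} (hθ : 1 < θ)
    (hA₀ : 1 / 4 ≤ A₀) (h1 : θ ^ 4 + θ ^ 21 ≤ 2 * θ ^ 13) (h2 : θ * A₀ ≤ 1)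
    (h3 : l * (θ ^ 24 * A) + (1 - l) * θ ^ 2 ≤ A)
    (h4 : l * (θ ^ 4 * A₁) + (1 - l) * (θ ^ 6 * A₀) ≤ A₀)
    (h5 : l * (θ ^ 44 * A) + (1 - l) * (θ ^ 3 / 4) ≤ A₁)
    (k : Config) (h : largestInv k) :
    mean firstLargestMachine (fun _ => l) (largestLyapunov θ A A₀ A₁) k ≤
      θ⁻¹ * largestLyapunov θ A A₀ A₁ k := by
  have hpc := largestInv_pc_le h
  have hθ0 : 0 < θ := by linarith
  have hexit (m : ℕ) : growth θ 1 4 m + growth θ 1 21 m ≤ 2 * growth θ 1 13 m := by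
    have := mul_le_mul_of_nonneg_right h1 (by positivity : 0 ≤ θ ^ (20 * m))
    simp only [growth, pow_add]
    linarith
  obtain ⟨pc, ctr, str, f, c⟩ := k
  dsimp only at hpc
  interval_cases pc <;> simp [largestInv] at h
  on_goal 24 =>
    refine mean_le_of_forall hθ0 fun a b => ?_
    simp [largestLyapunov, step, firstLargestMachine, Instr.exec, mul_growth]
    split_ifs <;> exact growth_mono hθ (by norm_num) le_rfl (by omega)
  on_goal 22 =>
    refine mean_le_of_forall hθ0 fun a b => ?_
    simp [largestLyapunov, step, firstLargestMachine, Instr.exec, mul_growth]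
    split_ifs <;> exact growth_mono hθ (by norm_num) (by norm_num) (by omega)
  on_goal 21 =>
    refine mean_le_of_flip hθ0 fun b => ?_
    simp [largestLyapunov, step, firstLargestMachine, Instr.exec, mul_growth]
    have : growth θ 1 2 (ctr 1) ≤ growth θ 1 4 (ctr 1) :=
      growth_mono hθ (by norm_num) le_rfl (by omega)
    linarith [hexit (ctr 1)]
  on_goal 20 =>
    refine mean_le_of_forall hθ0 fun a b => ?_
    simp [largestLyapunov, step, firstLargestMachine, Instr.exec, mul_growth]
    split_ifs <;> exact growth_mono hθ (by norm_num) le_rfl (by omega)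
  on_goal 18 =>
    refine mean_le_of_flip hθ0 fun b => ?_
    simp [largestLyapunov, step, firstLargestMachine, Instr.exec, mul_growth]
    have : growth θ A₀ 4 0 ≤ growth θ 1 4 (ctr 1) :=
      growth_mono hθ (by linarith) (by nlinarith) (by omega)
    linarith [hexit (ctr 1)]
  on_goal 13 =>
    refine mean_le_of_flip hθ0 fun b => ?_
    simp [largestLyapunov, step, firstLargestMachine, Instr.exec, mul_growth]
    linarith
  on_goal 12 =>
    refine mean_le_of_forall hθ0 fun a b => ?_
    rcases hr : (str 0)[ctr 2]? with _ | _ | _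
    · have := List.getElem?_eq_none_iff.1 hr
      simp [largestLyapunov, step, firstLargestMachine, Instr.exec, mul_growth, not_lt.2 this]
    all_goals
      have := lt_length_of_getElem? hr
      simp [largestLyapunov, step, firstLargestMachine, Instr.exec, hr, mul_growth]
      rw [if_pos this]
  on_goal 11 =>
    refine mean_le_of_forall hθ0 fun a b => ?_
    simp [largestLyapunov, step, firstLargestMachine, Instr.exec, mul_growth]
    split_ifs <;> exact growth_mono hθ (by norm_num) le_rfl (by omega)
  on_goal 10 =>
    refine mean_le_of_forall hθ0 fun a b => ?_
    rcases hm : ctr 1 with _ | m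
    · simp [largestLyapunov, step, firstLargestMachine, Instr.exec, hm]
      exact le_growth _ _ hθ (by norm_num) (by norm_num)
    · simp [largestLyapunov, step, firstLargestMachine, Instr.exec, mul_growth, hm]
      exact growth_mono hθ (by norm_num) le_rfl (by omega)
  on_goal 9 =>
    refine mean_le_of_forall hθ0 fun a b => ?_
    rcases hm : ctr 1 with _ | _ | m <;>
      simp [largestLyapunov, step, firstLargestMachine, Instr.exec, mul_growth, hm]
    exact growth_mono hθ (by norm_num) le_rfl (by omega)
  on_goal 7 =>
    refine mean_le_of_forall hθ0 fun a b => ?_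
    simp [largestLyapunov, step, firstLargestMachine, Instr.exec, mul_growth]
  on_goal 4 =>
    refine mean_le_of_call hθ0 fun a => ?_
    rcases hm : ctr 1 with _ | _ | m
    · simp [largestLyapunov, step, firstLargestMachine, Instr.exec, mul_growth, hm]
      simp only [growth, mul_zero, add_zero]
      linarith
    · simp [largestLyapunov, step, firstLargestMachine, Instr.exec, mul_growth, growth_succ, hm]
      simp only [growth, mul_zero, add_zero]
      linarith
    · simp [largestLyapunov, step, firstLargestMachine, Instr.exec, mul_growth, hm]
      have := mul_le_mul_of_nonneg_right h3 (by positivity : 0 ≤ θ ^ (20 * (m + 1 + 1)))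
      simp only [growth]
      ring_nf at this ⊢
      linarith
  all_goals
    refine mean_le_of_forall hθ0 fun a b => ?_
    simp [largestLyapunov, step, firstLargestMachine, Instr.exec, mul_growth, h]

theorem largestLyapunov_ge {θ A A₀ A₁ : ℝ} (hθ : 1 < θ) (hA : 1 ≤ A) (hA₀ : 1 / 4 ≤ A₀)
    (hA₁ : 1 / 4 ≤ A₁) (k : Config) (h : largestInv k) (hk : k.pc ≠ 24) : 1 / 4 ≤ largestLyapunov θ A A₀ A₁ k := by
  have hpc := largestInv_pc_le h
  obtain ⟨pc, ctr, str, f, c⟩ := k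
  dsimp only at hpc hk
  interval_cases pc <;> simp only [largestLyapunov] <;> (try split_ifs) <;>
    first
      | exact absurd rfl hk
      | exact le_growth _ _ hθ (by linarith) (by linarith)

theorem firstLargestMachine_decaysGeometrically : DecaysGeometrically firstLargestMachine := by
  intro lam h0 h1
  obtain ⟨θ, A, A₀, A₁, hθ, hA, hA₀, hA₁, e1, e2, -, e3, e4, e5⟩ :=
    exists_lyapunov_constants (l := lam) h0 h1
  refine ⟨largestInv, fun k => 4 * largestLyapunov θ A A₀ A₁ k, θ⁻¹, by positivity,
    inv_lt_one_of_one_lt₀ hθ, trivial, fun ω k hk => ?_, fun k hk => ⟨?_, fun hh => ?_, ?_⟩⟩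
  · rw [step_eq_constSource]
    exact largestInv_step _ _ k hk
  · by_cases h : k.pc = 24
    · simp [largestLyapunov, h]
    · have := largestLyapunov_ge hθ hA hA₀ hA₁ k hk h
      linarith
  · have := largestLyapunov_ge hθ hA hA₀ hA₁ k hk fun h =>
      hh ⟨0, by simp [h, firstLargestMachine], trivial⟩
    linarith
  · rw [mean_const_mul]
    have := mean_largestLyapunov hθ hA₀ e1 e2 e3 e4 e5 k hk
    linarith

/-! ### The order type of independent uniform variables -/

theorem measurableSet_orderType_eq {n : ℕ} (σ : Equiv.Perm (Fin n)) :
    MeasurableSet {u : Fin n → unitInterval | orderType u = σ} := by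
  have : {u : Fin n → unitInterval | orderType u = σ} =
      {u | (∀ i j, i ≤ j → u (σ⁻¹ i) ≤ u (σ⁻¹ j)) ∧
        ∀ i j, i < j → u (σ⁻¹ i) = u (σ⁻¹ j) → σ⁻¹ i < σ⁻¹ j} := by
    ext u
    simp only [Set.mem_ofPred_eq, orderType, inv_eq_iff_eq_inv]
    rw [eq_comm, Tuple.eq_sort_iff]
    rfl
  rw [this]
  have h1 (i j : Fin n) : Measurable fun u : Fin n → unitInterval => u (σ⁻¹ i) ≤ u (σ⁻¹ j) :=
    measurableSet_setOfPred.1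
      (measurableSet_le (measurable_pi_apply _) (measurable_pi_apply _))
  have h2 (i j : Fin n) : Measurable fun u : Fin n → unitInterval => u (σ⁻¹ i) = u (σ⁻¹ j) :=
    measurableSet_setOfPred.1
      (measurableSet_eq_fun (measurable_pi_apply _) (measurable_pi_apply _))
  refine measurableSet_setOfPred.2 (.and ?_ ?_) <;>
    refine .forall fun i => .forall fun j => .imp measurable_const ?_
  · exact h1 i j
  · exact .imp (h2 i j) measurable_const

theorem measurableSet_orderType_mem {n : ℕ} (S : Set (Equiv.Perm (Fin n))) :
    MeasurableSet {u : Fin n → unitInterval | orderType u ∈ S} := by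
  have : {u : Fin n → unitInterval | orderType u ∈ S} =
      ⋃ σ ∈ S, {u | orderType u = σ} := by ext; simp
  rw [this]
  exact .biUnion S.to_countable fun σ _ => measurableSet_orderType_eq σ

/-- Independent uniform variables on `[0, 1]`. -/
noncomputable abbrev uniformProduct (ι : Type*) : Measure (ι → unitInterval) :=
  Measure.infinitePi fun _ => volume

theorem uniformProduct_eq_null {ι : Type*} {i j : ι} (hij : i ≠ j) :
    uniformProduct ι {u | u i = u j} = 0 := by
  have h := Measure.infinitePi_map_eval_prod
    (P := fun _ : ι => (volume : Measure unitInterval)) hij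
  have hd : MeasurableSet {z : unitInterval × unitInterval | z.1 = z.2} :=
    measurableSet_eq_fun measurable_fst measurable_snd
  have : uniformProduct ι {u | u i = u j} =
      ((volume : Measure unitInterval).prod volume) {z | z.1 = z.2} := by
    rw [← h, Measure.map_apply (by fun_prop) hd]
    rfl
  rw [this, Measure.measure_prod_null hd]
  filter_upwards with a
  have : Prod.mk a ⁻¹' {z : unitInterval × unitInterval | z.1 = z.2} = {a} := by
    ext; simp [eq_comm]
  rw [this, measure_singleton]
  rfl

theorem ae_injective_uniformProduct (n : ℕ) :
    ∀ᵐ u ∂uniformProduct (Fin n), Function.Injective u := by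
  have : ∀ᵐ u ∂uniformProduct (Fin n), ∀ z : Fin n × Fin n, z.1 ≠ z.2 → u z.1 ≠ u z.2 := by
    refine ae_all_iff.2 fun z => ?_
    by_cases hz : z.1 = z.2
    · exact .of_forall fun u h => absurd hz h
    · refine (ae_iff.2 ?_ : ∀ᵐ u ∂uniformProduct (Fin n), u z.1 ≠ u z.2).mono fun u h _ => h
      simpa using uniformProduct_eq_null hz
  filter_upwards [this] with u hu i j h
  by_contra hij
  exact hu (i, j) hij h

/-- Injectivity matters because `Tuple.sort` breaks ties by position, which permuting the
coordinates does not respect. -/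
theorem orderType_comp_perm {n : ℕ} {u : Fin n → unitInterval} (hu : Function.Injective u)
    (τ : Equiv.Perm (Fin n)) : orderType (u ∘ τ) = orderType u * τ := by
  have : τ⁻¹ * Tuple.sort u = Tuple.sort (u ∘ τ) := by
    rw [Tuple.eq_sort_iff]
    have e : (u ∘ τ) ∘ (τ⁻¹ * Tuple.sort u : Equiv.Perm (Fin n)) = u ∘ Tuple.sort u := by
      ext i; simp
    rw [e]
    refine ⟨Tuple.monotone_sort u, fun i j hij h => ?_⟩
    exact absurd ((hu.comp τ.injective).comp (Equiv.injective _) h) hij.ne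
  rw [orderType, ← this, orderType]
  group

/-- Permuting the coordinates by `σ` preserves the product law and, off the null set of ties,
multiplies the order type by `σ`. Hence all `n!` order types are equally likely. -/
theorem uniformProduct_orderType_eq {n : ℕ} (σ : Equiv.Perm (Fin n)) :
    uniformProduct (Fin n) {u | orderType u = σ} = (n.factorial : ENNReal)⁻¹ := by
  have hconst (σ : Equiv.Perm (Fin n)) : uniformProduct (Fin n) {u | orderType u = σ} =
      uniformProduct (Fin n) {u | orderType u = 1} := by
    have h := Measure.map_infinitePi_infinitePi_of_inj
      (P := fun _ : Fin n => (volume : Measure unitInterval)) σ.injective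
    change _ = uniformProduct (Fin n) at h
    conv_lhs => rw [← h, Measure.map_apply (by fun_prop) (measurableSet_orderType_eq σ)]
    refine measure_congr ?_
    filter_upwards [ae_injective_uniformProduct n] with u hu
    have e : orderType (fun i => u (σ i)) = orderType u * σ := orderType_comp_perm hu σ
    change (orderType (fun i => u (σ i)) = σ) = (orderType u = 1)
    rw [e, mul_eq_right]
  have hsum : ∑ σ : Equiv.Perm (Fin n), uniformProduct (Fin n) {u | orderType u = σ} = 1 := by
    have := sum_measure_preimage_singleton (μ := uniformProduct (Fin n)) Finset.univ
      (f := fun u : Fin n → unitInterval => orderType u) fun σ _ => measurableSet_orderType_eq σ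
    rw [Finset.coe_univ, Set.preimage_univ, measure_univ] at this
    exact this
  simp_rw [hconst] at hsum ⊢
  rw [Finset.sum_const, Finset.card_univ, Fintype.card_perm, Fintype.card_fin, nsmul_eq_mul] at hsum
  exact ENNReal.eq_inv_of_mul_eq_one_left (by rwa [mul_comm] at hsum)

/-! ### Success probabilities of the trials of the schema, and their independence. -/

theorem egfCoeff_mem (P : PermClass) (n : ℕ) : 0 ≤ egfCoeff P n ∧ egfCoeff P n ≤ 1 := by
  refine ⟨by unfold egfCoeff; positivity, ?_⟩
  rw [egfCoeff, div_le_one (by positivity)]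
  have := Set.ncard_le_card (P n)
  rw [Nat.card_eq_fintype_card, Fintype.card_perm, Fintype.card_fin] at this
  exact_mod_cast this

theorem uniformProduct_orderType_mem (P : PermClass) (n : ℕ) :
    uniformProduct (Fin n) {u | orderType u ∈ P n} = ENNReal.ofReal (egfCoeff P n) := by
  have := sum_measure_preimage_singleton (μ := uniformProduct (Fin n)) (P n).toFinite.toFinset
    (f := fun u : Fin n → unitInterval => orderType u) fun σ _ => measurableSet_orderType_eq σ
  rw [Set.Finite.coe_toFinset] at this
  change _ = uniformProduct (Fin n) {u | orderType u ∈ P n} at this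
  rw [← this]
  change ∑ σ ∈ _, uniformProduct (Fin n) {u | orderType u = σ} = _
  simp_rw [uniformProduct_orderType_eq]
  rw [Finset.sum_const, ← Set.ncard_eq_toFinset_card, nsmul_eq_mul, egfCoeff,
    ENNReal.ofReal_div_of_pos (by positivity), ENNReal.ofReal_natCast, ENNReal.ofReal_natCast,
    div_eq_mul_inv]

/-- The sequences of entries with which a trial of size `N` succeeds. -/
def successSet (P : PermClass) (N : ℕ) : Set (ℕ → unitInterval) :=
  {v | orderType (fun j : Fin N => v j) ∈ P N}

theorem measurableSet_successSet (P : PermClass) (N : ℕ) : MeasurableSet (successSet P N) :=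
  (measurable_pi_lambda (fun (v : ℕ → unitInterval) (j : Fin N) => v j)
    fun _ => measurable_pi_apply _) (measurableSet_orderType_mem (P N))

theorem uniformProduct_successSet (P : PermClass) (N : ℕ) :
    uniformProduct ℕ (successSet P N) = ENNReal.ofReal (egfCoeff P N) := by
  rw [← uniformProduct_orderType_mem, uniformProduct, uniformProduct,
    ← Measure.map_infinitePi_infinitePi_of_inj (P := fun _ : ℕ => (volume : Measure unitInterval))
      Fin.val_injective (α := Fin N), Measure.map_apply (by fun_prop)
      (measurableSet_orderType_mem _)]
  rfl

theorem uniformProduct_successSet_compl (P : PermClass) (N : ℕ) :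
    uniformProduct ℕ (successSet P N)ᶜ = ENNReal.ofReal (1 - egfCoeff P N) := by
  rw [prob_compl_eq_one_sub (measurableSet_successSet P N), uniformProduct_successSet,
    ENNReal.ofReal_sub _ (egfCoeff_mem P N).1, ENNReal.ofReal_one]

/-- The trials of the schema are independent. -/
theorem uniformProduct_first_success (P : PermClass) (x : ℕ → Bool) (k : ℕ) :
    uniformProduct (ℕ × ℕ) {U | (∀ i < k, ¬ TrialSucceeds P x U i) ∧ TrialSucceeds P x U k} =
      ENNReal.ofReal ((∏ i ∈ Finset.range k, (1 - egfCoeff P (trialSize x i))) *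
        egfCoeff P (trialSize x k)) := by
  have hc := Measure.infinitePi_map_curry
    (fun _ _ : ℕ => (volume : Measure unitInterval))
  let t (i : ℕ) : Set (ℕ → unitInterval) :=
    if i = k then successSet P (trialSize x i) else (successSet P (trialSize x i))ᶜ
  have ht (i : ℕ) : MeasurableSet (t i) := by
    simp only [t]
    split_ifs
    · exact measurableSet_successSet _ _
    · exact (measurableSet_successSet _ _).compl
  have hS : {U : ℕ × ℕ → unitInterval |
      (∀ i < k, ¬ TrialSucceeds P x U i) ∧ TrialSucceeds P x U k} =
      MeasurableEquiv.curry ℕ ℕ unitInterval ⁻¹'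
        (((Finset.range (k + 1) : Finset ℕ) : Set ℕ).pi t) := by
    ext U
    simp only [Set.mem_ofPred_eq, Set.mem_preimage, Set.mem_pi, Finset.coe_range, Set.mem_Iio]
    constructor
    · rintro ⟨h1, h2⟩ i hi
      rcases (Nat.lt_succ_iff.1 hi).eq_or_lt with rfl | hlt
      · simp only [t, if_pos]
        exact h2
      · simp only [t, if_neg hlt.ne]
        exact h1 i hlt
    · intro h
      refine ⟨fun i hi => ?_, ?_⟩
      · have := h i (by omega)
        simp only [t, if_neg hi.ne] at this
        exact this
      · have := h k (by omega)
        simp only [t, if_pos] at this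
        exact this
  rw [hS, uniformProduct, ← Measure.map_apply (MeasurableEquiv.measurable _)
    (.pi (Finset.countable_toSet _) fun i _ => ht i), hc,
    Measure.infinitePi_pi _ fun i _ => ht i, Finset.prod_range_succ,
    ENNReal.ofReal_mul (Finset.prod_nonneg fun i _ => sub_nonneg.2 (egfCoeff_mem P _).2),
    ENNReal.ofReal_prod_of_nonneg fun i _ => sub_nonneg.2 (egfCoeff_mem P _).2]
  congr 1
  · refine Finset.prod_congr rfl fun i hi => ?_
    rw [← uniformProduct_successSet_compl]
    simp only [t, if_neg (Finset.mem_range.1 hi).ne]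
  · rw [← uniformProduct_successSet]
    simp only [t, if_pos]

/-! ### The von Neumann schema for a fixed sequence of generator outcomes -/

theorem geometric_spec {x : ℕ → Bool} {s : ℕ} (h : ∃ n, x (s + n) = false) :
    x (s + geometric x s) = false ∧ ∀ i < geometric x s, x (s + i) = true := by
  refine ⟨Nat.sInf_mem (s := {n | x (s + n) = false}) h, fun i hi => ?_⟩
  have : i ∉ {n | x (s + n) = false} := Nat.notMem_of_lt_sInf hi
  simpa using this

theorem consumed_strictMono (x : ℕ → Bool) : StrictMono (consumed x) :=
  strictMono_nat_of_lt_succ fun k => by simp only [consumed]; omega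

theorem measurable_geometric (s : ℕ) : Measurable fun x : ℕ → Bool => geometric x s := by
  refine measurable_to_countable' fun n => ?_
  have hx (i : ℕ) (b : Bool) : MeasurableSet {x : ℕ → Bool | x i = b} :=
    measurableSet_eq_fun (measurable_pi_apply i) measurable_const
  -- The second set records the default `sInf ∅ = 0` for sequences without a failure from place `s`
  -- on.
  have e : (fun x : ℕ → Bool => geometric x s) ⁻¹' {n} =
      ({x | x (s + n) = false} ∩ ⋂ i < n, {x | x (s + i) = true}) ∪
        (if n = 0 then ⋂ i, {x | x (s + i) = true} else ∅) := by
    ext x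
    by_cases h : ∃ n, x (s + n) = false
    · obtain ⟨h1, h2⟩ := geometric_spec h
      have hn : x ∉ (if n = 0 then ⋂ i, {x : ℕ → Bool | x (s + i) = true} else ∅) := by
        split_ifs
        · simpa using h
        · simp
      simp only [Set.mem_preimage, Set.mem_singleton_iff, Set.mem_union, hn, or_false,
        Set.mem_inter_iff, Set.mem_ofPred_eq, Set.mem_iInter]
      constructor
      · rintro rfl
        exact ⟨h1, h2⟩
      · rintro ⟨g1, g2⟩
        by_contra hne
        rcases lt_or_gt_of_ne hne with hlt | hlt
        · simp [g2 _ hlt] at h1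
        · simp [h2 _ hlt] at g1
    · have h0 : geometric x s = 0 := by
        simp only [geometric]
        rw [show {n | x (s + n) = false} = ∅ from Set.eq_empty_of_forall_notMem
          fun n hn => h ⟨n, hn⟩, Nat.sInf_empty]
      simp only [not_exists, Bool.not_eq_false] at h
      by_cases hn : n = 0
      · simp [h0, hn, h]
      · simp [h0, hn, h, Ne.symm hn]
  rw [e]
  refine .union (.inter (hx _ _) (.iInter fun i => .iInter fun _ => hx _ _)) ?_
  split_ifs
  · exact .iInter fun i => hx _ _
  · exact .empty

theorem measurable_geometric_comp {g : (ℕ → Bool) → ℕ} (hg : Measurable g) :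
    Measurable fun x => geometric x (g x) := by
  have : Measurable fun z : ℕ × (ℕ → Bool) => geometric z.2 z.1 :=
    measurable_from_prod_countable_right fun s => measurable_geometric s
  exact this.comp (hg.prodMk measurable_id)

theorem measurable_consumed (k : ℕ) : Measurable fun x => consumed x k := by
  induction k with
  | zero => exact measurable_const
  | succ k ih =>
    simp only [consumed]
    exact (ih.add (measurable_geometric_comp ih)).add measurable_const

theorem measurable_trialSize (k : ℕ) : Measurable fun x => trialSize x k :=
  measurable_geometric_comp (measurable_consumed k)

theorem measurableSet_trialSucceeds (P : PermClass) (k : ℕ) :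
    MeasurableSet {η : (ℕ → Bool) × (ℕ × ℕ → unitInterval) | TrialSucceeds P η.1 η.2 k} := by
  have e : {η : (ℕ → Bool) × (ℕ × ℕ → unitInterval) | TrialSucceeds P η.1 η.2 k} =
      ⋃ N, {η | trialSize η.1 k = N} ∩
        {η | (fun j : ℕ => η.2 (k, j)) ∈ successSet P N} := by
    ext η
    simp [TrialSucceeds, successSet]
  rw [e]
  refine .iUnion fun N => .inter
    (((measurable_trialSize k).comp measurable_fst) (measurableSet_singleton N)) ?_
  have : Measurable fun η : (ℕ → Bool) × (ℕ × ℕ → unitInterval) => fun j : ℕ => η.2 (k, j) :=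
    measurable_pi_lambda _ fun j => (measurable_pi_apply _).comp measurable_snd
  exact this (measurableSet_successSet P N)

theorem measurableSet_schemaReturns (P : PermClass) (n c : ℕ) :
    MeasurableSet {η : (ℕ → Bool) × (ℕ × ℕ → unitInterval) |
      SchemaReturns P η.1 η.2 n c} := by
  have hT (k) := measurableSet_setOfPred.1 (measurableSet_trialSucceeds P k)
  have hN (k) : Measurable fun η : (ℕ → Bool) × (ℕ × ℕ → unitInterval) =>
      trialSize η.1 k = n :=
    measurableSet_setOfPred.1
      (((measurable_trialSize k).comp measurable_fst) (measurableSet_singleton n))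
  have hC (k) : Measurable fun η : (ℕ → Bool) × (ℕ × ℕ → unitInterval) =>
      consumed η.1 k = c :=
    measurableSet_setOfPred.1
      (((measurable_consumed k).comp measurable_fst) (measurableSet_singleton c))
  exact measurableSet_setOfPred.2 (.exists fun k =>
    .and (.forall fun i => .imp measurable_const (hT i).not)
      (.and (hT k) (.and (hN k) (hC (k + 1)))))

/-- The probability that the schema stops with output `n` after `c₀` calls, given that `c` calls
have been made, with `N` successes in the current trial; the first argument bounds the number of
calls still to be made. -/
noncomputable def schemaValue (e : ℕ → ℝ) (x : ℕ → Bool) (n c₀ : ℕ) : ℕ → ℕ → ℕ → ℝ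
  | 0, _, _ => 0
  | t + 1, N, c =>
      if x c then schemaValue e x n c₀ t (N + 1) (c + 1)
      else e N * (if N = n ∧ c + 1 = c₀ then 1 else 0) +
        (1 - e N) * schemaValue e x n c₀ t 0 (c + 1)

theorem schemaValue_mem {e : ℕ → ℝ} (he : ∀ N, 0 ≤ e N ∧ e N ≤ 1) (x : ℕ → Bool)
    (n c₀ t N c : ℕ) : 0 ≤ schemaValue e x n c₀ t N c ∧ schemaValue e x n c₀ t N c ≤ 1 := by
  induction t generalizing N c with
  | zero => simp [schemaValue]
  | succ t ih =>
    simp only [schemaValue]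
    split_ifs
    · exact ih _ _
    all_goals
      obtain ⟨h1, h2⟩ := he N
      obtain ⟨h3, h4⟩ := ih 0 (c + 1)
      constructor <;> nlinarith

/-- With `c₀ - c` calls left, the truncated subtraction is harmless: for `c ≥ c₀` both sides vanish,
since the total can no longer be `c₀`. The recursion therefore holds for all `N` and `c`, as
`HasTrialValue` demands. -/
theorem schemaValue_rec (e : ℕ → ℝ) (x : ℕ → Bool) (n c₀ N c : ℕ) :
    schemaValue e x n c₀ (c₀ - c) N c =
      if x c then schemaValue e x n c₀ (c₀ - (c + 1)) (N + 1) (c + 1)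
      else e N * (if N = n ∧ c + 1 = c₀ then 1 else 0) +
        (1 - e N) * schemaValue e x n c₀ (c₀ - (c + 1)) 0 (c + 1) := by
  rcases lt_or_ge c c₀ with h | h
  · rw [show c₀ - c = (c₀ - (c + 1)) + 1 by omega, schemaValue]
  · rw [show c₀ - c = 0 by omega, show c₀ - (c + 1) = 0 by omega,
      if_neg (show ¬ (N = n ∧ c + 1 = c₀) by omega)]
    simp [schemaValue]

theorem schemaValue_of_run (e : ℕ → ℝ) (x : ℕ → Bool) (n c₀ g N c : ℕ)
    (h1 : x (c + g) = false) (h2 : ∀ i < g, x (c + i) = true) :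
    schemaValue e x n c₀ (c₀ - c) N c =
      e (N + g) * (if N + g = n ∧ c + g + 1 = c₀ then 1 else 0) +
        (1 - e (N + g)) * schemaValue e x n c₀ (c₀ - (c + g + 1)) 0 (c + g + 1) := by
  induction g generalizing N c with
  | zero => rw [schemaValue_rec]; simp_all
  | succ g ih =>
    have h0 := h2 0 (by omega)
    rw [add_zero] at h0
    rw [schemaValue_rec, if_pos h0, ih (N + 1) (c + 1) (by rw [← h1]; congr 1; ring)
      fun i hi => by rw [← h2 (i + 1) (by omega)]; congr 1; ring]
    rw [show N + 1 + g = N + (g + 1) by ring, show c + 1 + g + 1 = c + (g + 1) + 1 by ring]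

theorem schemaValue_trial {e : ℕ → ℝ} {x : ℕ → Bool} (hx : ∀ s, ∃ i, x (s + i) = false)
    (n c₀ k : ℕ) :
    schemaValue e x n c₀ (c₀ - consumed x k) 0 (consumed x k) =
      e (trialSize x k) * (if trialSize x k = n ∧ consumed x (k + 1) = c₀ then 1 else 0) +
        (1 - e (trialSize x k)) *
          schemaValue e x n c₀ (c₀ - consumed x (k + 1)) 0 (consumed x (k + 1)) := by
  obtain ⟨h1, h2⟩ := geometric_spec (hx (consumed x k))
  rw [schemaValue_of_run e x n c₀ _ 0 _ h1 h2, zero_add]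
  rfl

theorem schemaValue_prod {e : ℕ → ℝ} {x : ℕ → Bool} (hx : ∀ s, ∃ i, x (s + i) = false)
    (n c₀ k : ℕ) (hk : ∀ i < k, ¬ (trialSize x i = n ∧ consumed x (i + 1) = c₀)) :
    schemaValue e x n c₀ c₀ 0 0 = (∏ i ∈ Finset.range k, (1 - e (trialSize x i))) *
      schemaValue e x n c₀ (c₀ - consumed x k) 0 (consumed x k) := by
  induction k with
  | zero => simp [consumed]
  | succ k ih =>
    rw [ih fun i hi => hk i (by omega), schemaValue_trial hx, if_neg (hk k (by omega)),
      Finset.prod_range_succ]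
    ring

/-- For fixed `x` the sizes are deterministic, and `consumed x` is strictly increasing, so at most
one trial can end after `c` calls. The event says that this trial is the first success. -/
theorem uniformProduct_schemaReturns (P : PermClass) {x : ℕ → Bool}
    (hx : ∀ s, ∃ i, x (s + i) = false) (n c : ℕ) :
    uniformProduct (ℕ × ℕ) {U | SchemaReturns P x U n c} =
      ENNReal.ofReal (schemaValue (egfCoeff P) x n c c 0 0) := by
  have hmono := consumed_strictMono x
  by_cases h : ∃ k, trialSize x k = n ∧ consumed x (k + 1) = c
  · obtain ⟨k, h1, h2⟩ := h
    have huniq (i : ℕ) (hi : consumed x (i + 1) = c) : i = k := by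
      have := hmono.injective (hi.trans h2.symm)
      omega
    have hS : {U | SchemaReturns P x U n c} =
        {U | (∀ i < k, ¬ TrialSucceeds P x U i) ∧ TrialSucceeds P x U k} := by
      ext U
      constructor
      · rintro ⟨i, g1, g2, -, g4⟩
        obtain rfl := huniq i g4
        exact ⟨g1, g2⟩
      · rintro ⟨g1, g2⟩
        exact ⟨k, g1, g2, h1, h2⟩
    rw [hS, uniformProduct_first_success, schemaValue_prod hx n c k
      fun i hi hc => hi.ne (huniq i hc.2), schemaValue_trial hx, if_pos ⟨h1, h2⟩, h2,
      Nat.sub_self]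
    simp [schemaValue]
  · have hS : {U | SchemaReturns P x U n c} = ∅ := by
      refine Set.eq_empty_of_forall_notMem fun U ⟨k, _, _, g3, g4⟩ => h ⟨k, g3, g4⟩
    -- After `c` trials at least `c` calls have been used, so unfolding that many trials exhausts
    -- the bound and leaves `0`.
    rw [hS, measure_empty, schemaValue_prod hx n c c fun i _ hc => h ⟨i, hc⟩,
      Nat.sub_eq_zero_of_le (show c ≤ consumed x c from hmono.id_le c)]
    simp [schemaValue]

/-! ### Machine against schema -/

theorem ae_exists_false {lam : unitInterval} (h1 : lam < 1) :
    ∀ᵐ x ∂bernoulliSequence lam, ∀ s, ∃ i, x (s + i) = false := by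
  rw [ae_all_iff]
  intro s
  rw [ae_iff]
  have hle (n : ℕ) : bernoulliSequence lam {x | ¬ ∃ i, x (s + i) = false} ≤
      ENNReal.ofReal lam ^ n := by
    have hw : bernoulliMeasure true false lam {true} = ENNReal.ofReal lam := by
      rw [bernoulliMeasure_singleton]; simp [weight]
    calc _ ≤ bernoulliSequence lam
          (((Finset.Ico s (s + n) : Finset ℕ) : Set ℕ).pi fun _ => {true}) := by
          refine measure_mono fun x hx i hi => ?_
          simp only [Set.mem_ofPred_eq, not_exists, Bool.not_eq_false] at hx
          have := hx (i - s)
          rw [Finset.coe_Ico, Set.mem_Ico] at hi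
          rwa [Nat.add_sub_cancel' hi.1] at this
      _ = _ := by
          rw [bernoulliSequence, Measure.infinitePi_pi _ fun _ _ => measurableSet_singleton _]
          simp [hw]
  have hlim : Filter.Tendsto (fun n : ℕ => ENNReal.ofReal lam ^ n) Filter.atTop (nhds 0) :=
    ENNReal.tendsto_pow_atTop_nhds_zero_of_lt_one (ENNReal.ofReal_lt_one.2 h1)
  exact le_antisymm (ge_of_tendsto' hlim hle) zero_le

/-- Parameters `0` and `1` turn the generator into the Dirac mass at `x`, so conditioning on the
outcomes becomes a case of the variable source. -/
theorem variableSource_indicator_apply (x : ℕ → Bool) {S : Set Source} (hS : MeasurableSet S) :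
    variableSource (fun i => if x i then 1 else 0) S =
      bernoulliSequence half {a | (a, x) ∈ S} := by
  have : (bernoulliProduct fun i => if x i then 1 else 0) = Measure.dirac x := by
    rw [← Measure.infinitePi_dirac]
    congr! 2 with i
    cases hb : x i <;> simp [hb]
  rw [variableSource, this, Measure.prod_dirac, Measure.map_apply (by fun_prop) hS]
  rfl

instance (q : unitInterval) : IsProbabilityMeasure (bernoulliSequence q) := by
  unfold bernoulliSequence; infer_instance

theorem bernoulliSequence_haltsWith {p : Program} {e : ℕ → ℝ} (hp : HasTrialValue p e)
    (he : ∀ N, 0 ≤ e N ∧ e N ≤ 1) {x : ℕ → Bool}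
    (hx : ∀ᵐ a ∂bernoulliSequence half, ∃ n f c, HaltsWith p (a, x) n f c) (n c : ℕ) :
    bernoulliSequence half {a | ∃ f, HaltsWith p (a, x) n f c} =
      ENNReal.ofReal (schemaValue e x n c c 0 0) := by
  have hm := measurableSet_exists_haltsWith p fun n' c' => n' = n ∧ c' = c
  have hhalt : ∀ᵐ ω ∂variableSource (fun i => if x i then 1 else 0),
      ∃ n f c, HaltsWith p ω n f c := by
    have h := measurableSet_exists_haltsWith p fun _ _ => True
    simp only [and_true] at h
    rw [ae_iff] at hx ⊢
    rw [← hx]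
    exact variableSource_indicator_apply x h.compl
  have key := hp.measure_haltsWith (fun i => if x i then 1 else 0)
    (fun n' c' => n' = n ∧ c' = c) (fun N c' => schemaValue e x n c (c - c') N c')
    (fun N c' => schemaValue_mem he x n c _ _ _)
    (fun N c' => by rw [schemaValue_rec]; cases x c' <;> simp) hhalt
  rw [variableSource_indicator_apply x hm] at key
  rw [Nat.sub_zero] at key
  rw [← key]
  congr 1
  ext a
  constructor
  · rintro ⟨f, h⟩
    exact ⟨n, f, c, h, rfl, rfl⟩
  · rintro ⟨_, f, _, h, rfl, rfl⟩
    exact ⟨f, h⟩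

theorem HasTrialValue.implementsSchema {p : Program} {P : PermClass}
    (hp : HasTrialValue p (egfCoeff P)) (hd : DecaysGeometrically p) :
    ImplementsSchema p P := by
  intro lam h0 h1 A hA n c
  have hm : MeasurableSet {ω : Source | ω.input ∈ A ∧ ∃ f, HaltsWith p ω n f c} := by
    refine (measurable_snd hA).inter ?_
    have h := measurableSet_exists_haltsWith p fun n' c' => n' = n ∧ c' = c
    have e : {ω | ∃ n' f c', HaltsWith p ω n' f c' ∧ n' = n ∧ c' = c} =
        {ω | ∃ f, HaltsWith p ω n f c} := by
      ext ω
      constructor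
      · rintro ⟨_, f, _, h', rfl, rfl⟩
        exact ⟨f, h'⟩
      · rintro ⟨f, h'⟩
        exact ⟨n, f, c, h', rfl, rfl⟩
    rwa [e] at h
  have hm' : MeasurableSet {η : (ℕ → Bool) × (ℕ × ℕ → unitInterval) |
      η.1 ∈ A ∧ SchemaReturns P η.1 η.2 n c} :=
    (measurable_fst hA).inter (measurableSet_schemaReturns P n c)
  have hhalt : ∀ᵐ x ∂bernoulliSequence lam, ∀ᵐ a ∂bernoulliSequence half,
      ∃ n f c, HaltsWith p (a, x) n f c := by
    refine (Measure.ae_ae_comm ?_).1 (Measure.ae_ae_of_ae_prod (hd.ae_halts lam h0 h1))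
    simpa using measurableSet_exists_haltsWith p fun _ _ => True
  rw [source, schemaSource, Measure.prod_apply_symm hm, Measure.prod_apply hm']
  refine lintegral_congr_ae ?_
  filter_upwards [hhalt, ae_exists_false h1] with x hx hx'
  by_cases hxA : x ∈ A
  · have e1 := bernoulliSequence_haltsWith hp (egfCoeff_mem P) hx n c
    have e2 := uniformProduct_schemaReturns P hx' n c
    simpa [hxA] using e1.trans e2.symm
  · simp [hxA]

/-! ### The law of the output for a constant parameter. -/

theorem HasTrialValue.stronglySimulates {p : Program} {e : ℕ → ℝ} (hp : HasTrialValue p e)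
    (he : ∀ N, 0 ≤ e N ∧ e N ≤ 1) (hd : DecaysGeometrically p) {G : ℝ → ℝ}
    {law : ℝ → ℕ → ℝ} (hG : ∀ l : ℝ, 0 < l → l < 1 → HasSum (fun n => e n * l ^ n) (G l))
    (hG0 : ∀ l : ℝ, 0 < l → l < 1 → 0 < G l)
    (hlaw : ∀ l : ℝ, 0 < l → l < 1 → ∀ n, law l n = e n * l ^ n / G l) :
    StronglySimulates p law := by
  intro lam h0 h1
  have hhalt := hd.ae_halts lam h0 h1
  refine ⟨hhalt, fun n => ?_, hd.tail lam h0 h1⟩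
  obtain ⟨l, hl⟩ : ∃ l : ℝ, l = lam := ⟨_, rfl⟩
  have hl0 : 0 < l := hl ▸ h0
  have hl1 : l < 1 := hl ▸ h1
  rw [← hl]
  have hs := hG l hl0 hl1
  have hGpos := hG0 l hl0 hl1
  have hterm (i : ℕ) : 0 ≤ e i * l ^ i := mul_nonneg (he i).1 (pow_nonneg hl0.le i)
  obtain ⟨L, hL⟩ : ∃ L, L = law l n := ⟨_, rfl⟩
  have hLe : L * G l = e n * l ^ n := by
    rw [hL, hlaw l hl0 hl1]; field_simp
  have hL0 : 0 ≤ L := by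
    rw [hL, hlaw l hl0 hl1]; exact div_nonneg (hterm n) hGpos.le
  have hL1 : L ≤ 1 := by
    rw [hL, hlaw l hl0 hl1, div_le_one hGpos]
    exact le_hasSum hs n fun i _ => hterm i
  -- `(1 - l) * T N` is the probability that the current trial succeeds, given `N` successes of the
  -- generator so far.
  obtain ⟨T, hT⟩ : ∃ T : ℕ → ℝ, ∀ N, T N = (G l - ∑ i ∈ Finset.range N, e i * l ^ i) / l ^ N :=
    ⟨_, fun _ => rfl⟩
  have hTsum (N : ℕ) : HasSum (fun i => e (i + N) * l ^ i) (T N) := by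
    have h := ((hasSum_nat_add_iff' N).2 hs).div_const (l ^ N)
    have e' : (fun i => e (i + N) * l ^ (i + N) / l ^ N) = fun i => e (i + N) * l ^ i := by
      funext i
      rw [pow_add]
      field_simp
    rwa [e', ← hT] at h
  have hT0 : T 0 = G l := by simp [hT]
  have hTsucc (N : ℕ) : T N = e N + l * T (N + 1) := by
    rw [hT, hT, Finset.sum_range_succ, pow_succ]
    field_simp
    ring
  have hTnonneg (N : ℕ) : 0 ≤ T N :=
    (hTsum N).nonneg fun i => mul_nonneg (he _).1 (pow_nonneg hl0.le i)
  have hTle (N : ℕ) : (1 - l) * T N ≤ 1 := by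
    have h := hasSum_le (fun i => mul_le_of_le_one_left (pow_nonneg hl0.le i) (he (i + N)).2)
      (hTsum N) (hasSum_geometric_of_lt_one hl0.le hl1)
    rwa [← one_div, le_div_iff₀' (sub_pos.2 hl1)] at h
  have hTge (N : ℕ) (hN : N ≤ n) : e n * l ^ (n - N) ≤ T N := by
    have h := le_hasSum (hTsum N) (n - N) fun i _ => mul_nonneg (he _).1 (pow_nonneg hl0.le i)
    rwa [Nat.sub_add_cancel hN] at h
  -- The explicit solution of the recursion: either the current trial returns `n`, or it fails and a
  -- fresh start returns `n` with probability `L`. Consistency at `N = 0` is the equation `L * G l =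
  -- e n * l ^ n`.
  let v (N : ℕ) : ℝ :=
    (if N ≤ n then (1 - l) * (e n * l ^ (n - N)) else 0) + L * (1 - (1 - l) * T N)
  have hv0 : v 0 = L := by
    simp only [v, Nat.zero_le, if_true, Nat.sub_zero, hT0]
    linear_combination -(1 - l) * hLe
  have hv (N : ℕ) : 0 ≤ v N ∧ v N ≤ 1 := by
    have h2 := mul_nonneg hL0 (sub_nonneg.2 (hTle N))
    have h3 := mul_le_of_le_one_left (sub_nonneg.2 (hTle N)) hL1
    simp only [v]
    split_ifs with hN
    · have h4 : 0 ≤ e n * l ^ (n - N) := mul_nonneg (he n).1 (pow_nonneg hl0.le _)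
      have h5 := mul_nonneg (sub_nonneg.2 hl1.le) h4
      have h6 := mul_le_mul_of_nonneg_left (hTge N hN) (sub_nonneg.2 hl1.le)
      constructor <;> linarith
    · have h5 := mul_nonneg (sub_nonneg.2 hl1.le) (hTnonneg N)
      constructor <;> linarith
  have hrec (N : ℕ) : v N = l * v (N + 1) +
      (1 - l) * (e N * (if N = n then 1 else 0) + (1 - e N) * v 0) := by
    rw [hv0]
    simp only [v]
    rcases lt_trichotomy N n with hN | rfl | hN
    · rw [if_pos hN.le, if_pos (show N + 1 ≤ n by omega), if_neg hN.ne,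
        show n - N = (n - (N + 1)) + 1 by omega, pow_succ]
      linear_combination -(1 - l) * L * hTsucc N
    · rw [if_pos le_rfl, if_neg (show ¬ N + 1 ≤ N by omega), if_pos rfl, Nat.sub_self, pow_zero]
      linear_combination -(1 - l) * L * hTsucc N
    · rw [if_neg (show ¬ N ≤ n by omega), if_neg (show ¬ N + 1 ≤ n by omega), if_neg hN.ne']
      linear_combination -(1 - l) * L * hTsucc N
  have key := hp.measure_haltsWith (fun _ => lam) (fun n' _ => n' = n) (fun N _ => v N)
    (fun N _ => hv N) (fun N _ => by rw [← hl]; convert hrec N) hhalt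
  rw [hv0, hL] at key
  rw [← key, source_eq_variableSource]
  congr 1
  ext ω
  constructor
  · rintro ⟨f, c, h⟩
    exact ⟨n, f, c, h, rfl⟩
  · rintro ⟨_, f, c, h, rfl⟩
    exact ⟨f, c, h⟩

/-! ### The two generating functions -/

theorem egfCoeff_sortedClass : egfCoeff sortedClass = fun n => (n.factorial : ℝ)⁻¹ := by
  funext n
  have : sortedClass n = {1} := by
    ext σ
    exact Equiv.Perm.monotone_iff σ
  simp [egfCoeff, this]

/-- `Equiv.Perm.decomposeFin` separates the image of `0` from a permutation of `m` elements; the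
class fixes the former to be `Fin.last m` and leaves the latter free. -/
theorem ncard_firstLargestClass_succ (m : ℕ) :
    (firstLargestClass (m + 1)).ncard = m.factorial := by
  have h : firstLargestClass (m + 1) =
      Equiv.Perm.decomposeFin.symm '' (({Fin.last m} : Set (Fin (m + 1))) ×ˢ Set.univ) := by
    ext σ
    rw [Equiv.image_eq_preimage_symm, Equiv.symm_symm]
    obtain ⟨⟨a, τ⟩, rfl⟩ := Equiv.Perm.decomposeFin.symm.surjective σ
    simp only [Set.mem_preimage, Equiv.apply_symm_apply, Set.mem_prod, Set.mem_singleton_iff,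
      Set.mem_univ, and_true, firstLargestClass, Set.mem_ofPred_eq]
    constructor
    · rintro ⟨_, h⟩
      have := h ((Equiv.Perm.decomposeFin.symm (a, τ)).symm (Fin.last m))
      rw [Equiv.apply_symm_apply] at this
      change _ ≤ Equiv.Perm.decomposeFin.symm (a, τ) 0 at this
      rw [Equiv.Perm.decomposeFin_symm_apply_zero] at this
      exact Fin.last_le_iff.1 this
    · rintro rfl
      refine ⟨Nat.succ_pos m, fun i => ?_⟩
      change _ ≤ Equiv.Perm.decomposeFin.symm (Fin.last m, τ) 0
      rw [Equiv.Perm.decomposeFin_symm_apply_zero]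
      exact Fin.le_last _
  rw [h, Set.ncard_image_of_injective _ (Equiv.injective _), Set.ncard_prod, Set.ncard_singleton,
    one_mul, Set.ncard_univ, Nat.card_eq_fintype_card, Fintype.card_perm, Fintype.card_fin]

theorem egfCoeff_firstLargestClass : egfCoeff firstLargestClass = fun n : ℕ => (n : ℝ)⁻¹ := by
  funext n
  cases n with
  | zero =>
    have : firstLargestClass 0 = ∅ := by
      ext σ
      simp [firstLargestClass]
    simp [egfCoeff, this]
  | succ m =>
    have := m.factorial_ne_zero
    rw [egfCoeff, ncard_firstLargestClass_succ, Nat.factorial_succ]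
    push_cast
    field_simp

theorem hasSum_sortedClass (z : ℝ) :
    HasSum (fun n => egfCoeff sortedClass n * z ^ n) (Real.exp z) := by
  have h := NormedSpace.expSeries_div_hasSum_exp z
  rw [← Real.exp_eq_exp_ℝ] at h
  simpa only [egfCoeff_sortedClass, div_eq_inv_mul] using h

theorem hasSum_firstLargestClass {z : ℝ} (hz : |z| < 1) :
    HasSum (fun n => egfCoeff firstLargestClass n * z ^ n) (Real.log (1 - z)⁻¹) := by
  have h := Real.hasSum_pow_div_log_of_abs_lt_one hz
  rw [← Real.log_inv] at h
  -- The logarithmic series starts at `n = 1`; the term dropped by the shift is `0⁻¹ = 0`.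
  rw [egfCoeff_firstLargestClass, ← hasSum_nat_add_iff' 1]
  simpa [div_eq_inv_mul] using h

end Buffon
open Buffon

theorem theorem3 :
    (StronglySimulates sortedMachine poissonLaw ∧
      ImplementsSchema sortedMachine sortedClass ∧
      (stringRegisters sortedMachine).card = 1 ∧
      ∀ z : ℝ, HasSum (fun n => egfCoeff sortedClass n * z ^ n) (Real.exp z)) ∧
    (StronglySimulates firstLargestMachine logarithmicLaw ∧
      ImplementsSchema firstLargestMachine firstLargestClass ∧
      (stringRegisters firstLargestMachine).card = 1 ∧
      ∀ z : ℝ, |z| < 1 →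
        HasSum (fun n => egfCoeff firstLargestClass n * z ^ n) (Real.log (1 - z)⁻¹)) := by
  have hR : HasTrialValue sortedMachine (egfCoeff sortedClass) :=
    egfCoeff_sortedClass ▸ sortedMachine_hasTrialValue
  have hS : HasTrialValue firstLargestMachine (egfCoeff firstLargestClass) :=
    egfCoeff_firstLargestClass ▸ firstLargestMachine_hasTrialValue
  refine ⟨⟨?_, hR.implementsSchema sortedMachine_decaysGeometrically, by decide,
    hasSum_sortedClass⟩, ?_, hS.implementsSchema firstLargestMachine_decaysGeometrically,
    by decide, fun z => hasSum_firstLargestClass⟩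
  · refine hR.stronglySimulates (egfCoeff_mem _) sortedMachine_decaysGeometrically
      (fun l _ _ => hasSum_sortedClass l) (fun l _ _ => Real.exp_pos l) fun l _ _ n => ?_
    rw [egfCoeff_sortedClass, poissonLaw, Real.exp_neg]
    ring
  · refine hS.stronglySimulates (egfCoeff_mem _) firstLargestMachine_decaysGeometrically
      (fun l h0 h1 => hasSum_firstLargestClass (by rwa [abs_of_pos h0]))
      (fun l h0 h1 => Real.log_pos (one_lt_inv₀ (by linarith) |>.2 (by linarith)))
      fun l _ _ n => ?_
    rw [egfCoeff_firstLargestClass, logarithmicLaw]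
    split_ifs with hn
    · simp [hn]
    · ring
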